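/- For each $n\ge 1$ let $H=H_n$ be a finite graph with $v(H)\le n$ vertices and $e(H)$ edges. In the model of $H$ planted in $G(n,p)$, $p\in[0,1]$, one observes $\mathbf Y=\mathbf H\cup\mathbf G$, where $\mathbf H$ is a uniformly random copy of $H$ in the complete graph $K_n$ and $\mathbf G\sim G(n,p)$ is independent of $\mathbf H$. Identify graphs on the vertex set of $K_n$ with vectors in $\{0,1\}^{\binom n2}$ and put $\mathsf{MMSE}_n(p)=\mathbb E\big[\|\mathbf H-\mathbb E[\mathbf H\mid\mathbf Y]\|_2^2\big]$. The model exhibits the all-or-nothing (AoN) transition at linear scale at a critical probability $p_{\mathsf{AoN}}=p_{\mathsf{AoN}}(n)\in[0,1]$ if for every constant $\epsilon>0$, as $n\to\infty$, $\mathsf{MMSE}_n(p)/e(H_n)\to1$ uniformly over $p\in[0,1]$ with $p\ge(1+\epsilon)p_{\mathsf{AoN}}$, and $\mathsf{MMSE}_n(p)/e(H_n)\to0$ uniformly over $p\in[0,1]$ with $p\le(1-\epsilon)p_{\mathsf{AoN}}$; it exhibits AoN if it does so at some $p_{\mathsf{AoN}}$. For a graph $J$ with $v(J)\le n$ and $e(J)\ge1$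 let $M_J$ be the number of copies of $J$ in $K_n$ and let $p_{\mathsf{1M}}(J)=M_J^{-1/e(J)}$. For $q\in[0,1]$ let $$\psi_q(H)=\max\{p_{\mathsf{1M}}(J)\},\qquad \alpha_q(H)=\min\{v(J)/e(J)\},$$ both over the subgraphs $J\subseteq H$ with $e(J)\ge\max\{1,q\,e(H)\}$. **Theorem.** Suppose that $(H_n)$ is sufficiently dense, i.e. $v(H_n)\to\infty$ and $e(H_n)/(v(H_n)\log v(H_n))\to\infty$, and delocalized, i.e. there are constants $0<q\le1$ and $C<\infty$, not depending on $n$, such that $\alpha_q(H_n)\le\alpha_0(H_n)+C/\log n$ for all large $n$. Then the model of $H_n$ planted in $G(n,p)$ exhibits AoN if and only if $$\lim_{n\to\infty}\frac{\psi_q(H_n)}{\psi_{q'}(H_n)}=1\qquad\text{for all }q,q'\in(0,1).$$ Moreover, in this case $p_{\mathsf{AoN}}=(1+o(1))\,\psi_q(H_n)$ for every $q\in(0,1)$ (and every critical probability $p_{\mathsf{AoN}}$ at which the model exhibits AoN). -/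

import Mathlib

noncomputable section

namespace PlantedSubgraph

open MeasureTheory ProbabilityTheory Filter Topology

/-! ### Counting copies, first moment thresholds, generalized expectation thresholds -/

/-- The number of edges `e(G)`. -/
def edgeCount {V : Type*} (G : SimpleGraph V) : ℕ := G.edgeSet.ncard

/-- The first moment threshold `M_J ^ (-1 / e(J))` of a graph `J`, where `M_J` is the number of
subgraphs of `K_n` isomorphic to `J`: the solution `p` of `M_J * p ^ e(J) = 1`. -/
def firstMomentThreshold (n : ℕ) {W : Type*} (J : SimpleGraph W) : ℝ :=
  ((⊤ : SimpleGraph (Fin n)).copyCount J : ℝ) ^ (-(1 : ℝ) / (edgeCount J : ℝ))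

/-- `J ⊆ H` is a subgraph with at least one edge and at least a fraction `q` of the edges
of `H`. -/
def IsLarge {V : Type*} {H : SimpleGraph V} (q : ℝ) (J : H.Subgraph) : Prop :=
  max 1 (q * (edgeCount H : ℝ)) ≤ (edgeCount J.coe : ℝ)

/-- The generalized expectation threshold `ψ_q(H)`: the largest first moment threshold of a
subgraph of `H` with at least a fraction `q` of the edges (a maximum over a finite set). -/
def psi (n : ℕ) {k : ℕ} (q : ℝ) (H : SimpleGraph (Fin k)) : ℝ :=
  sSup {x : ℝ | ∃ J : H.Subgraph, IsLarge q J ∧ x = firstMomentThreshold n J.coe}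

/-- `α_q(H)`: the least value of `v(J) / e(J)` over the subgraphs `J` of `H` with at least a
fraction `q` of the edges. -/
def alpha {k : ℕ} (q : ℝ) (H : SimpleGraph (Fin k)) : ℝ :=
  sInf {x : ℝ | ∃ J : H.Subgraph, IsLarge q J ∧
    x = (J.verts.ncard : ℝ) / (edgeCount J.coe : ℝ)}

/-! ### The planted subgraph model -/

/-- Every set of subgraphs of `K_n` is measurable. -/
instance (n : ℕ) : MeasurableSpace (⊤ : SimpleGraph (Fin n)).Subgraph := ⊤

/-- The set of copies of `H` in the complete graph `K_n`. -/
def copies (n : ℕ) {k : ℕ} (H : SimpleGraph (Fin k)) :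
    Set (⊤ : SimpleGraph (Fin n)).Subgraph :=
  {S | Nonempty (H ≃g S.coe)}

/-- The joint law of `(S, G)`: the planted graph `S` is a uniformly random copy of `H` in `K_n`,
and `G` is an independent sample of the random graph `G(n, p)`. -/
def plantedLaw (n : ℕ) {k : ℕ} (H : SimpleGraph (Fin k)) (p : unitInterval) :
    Measure ((⊤ : SimpleGraph (Fin n)).Subgraph × SimpleGraph (Fin n)) :=
  (uniformOn (copies n H)).prod (SimpleGraph.binomialRandom (Fin n) p)

/-- The observed graph `Y = S ∪ G`, on the vertex set of `K_n`. -/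
def observation {n : ℕ} (ω : (⊤ : SimpleGraph (Fin n)).Subgraph × SimpleGraph (Fin n)) :
    SimpleGraph (Fin n) :=
  ω.1.spanningCoe ⊔ ω.2

/-- The coordinate of the planted graph at the potential edge `e`, in `{0, 1}`. -/
def signal {n : ℕ} (e : Sym2 (Fin n))
    (ω : (⊤ : SimpleGraph (Fin n)).Subgraph × SimpleGraph (Fin n)) : ℝ :=
  Set.indicator {ω' | e ∈ ω'.1.edgeSet} 1 ω

/-- The posterior mean `E[1_{e ∈ S} | Y = y]`, the expectation of the coordinate at `e` under the
law conditioned on the event `Y = y`. (The value at the `y` of probability zero is immaterial.) -/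
def posteriorMean (n : ℕ) {k : ℕ} (H : SimpleGraph (Fin k)) (p : unitInterval)
    (e : Sym2 (Fin n)) (y : SimpleGraph (Fin n)) : ℝ :=
  ∫ ω, signal e ω ∂(ProbabilityTheory.cond (plantedLaw n H p) (observation ⁻¹' {y}))

/-- The minimum mean squared error `E ‖S - E[S | Y]‖²`, where a graph is viewed as a binary vector
indexed by the edges of `K_n`. -/
def mmse (n : ℕ) {k : ℕ} (H : SimpleGraph (Fin k)) (p : unitInterval) : ℝ :=
  ∫ ω, ∑ e ∈ (⊤ : SimpleGraph (Fin n)).edgeFinset,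
    (signal e ω - posteriorMean n H p e (observation ω)) ^ 2 ∂(plantedLaw n H p)

/-! ### Properties of a sequence of graphs -/

variable {v : ℕ → ℕ}

/-- The model of `H n` planted in `G(n, p)` exhibits the all-or-nothing transition (at linear
scale) at the critical probability `pc`: for every `ε > 0` the normalized MMSE tends to `1` for
`p ≥ (1 + ε) pc`, and to `0` for `p ≤ (1 - ε) pc`, where `p` may vary with `n`. -/
def ExhibitsAoNAt (H : ∀ n, SimpleGraph (Fin (v n))) (pc : ℕ → unitInterval) : Prop :=
  ∀ ε : ℝ, 0 < ε → ∀ δ : ℝ, 0 < δ → ∀ᶠ n in atTop, ∀ p : unitInterval,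
    ((1 + ε) * (pc n : ℝ) ≤ (p : ℝ) → |mmse n (H n) p / (edgeCount (H n) : ℝ) - 1| ≤ δ) ∧
    ((p : ℝ) ≤ (1 - ε) * (pc n : ℝ) → |mmse n (H n) p / (edgeCount (H n) : ℝ)| ≤ δ)

/-- The model exhibits the all-or-nothing transition at some critical probability. -/
def ExhibitsAoN (H : ∀ n, SimpleGraph (Fin (v n))) : Prop :=
  ∃ pc : ℕ → unitInterval, ExhibitsAoNAt H pc

/-- Sufficiently dense: `v(H_n) → ∞` and `e(H_n) / (v(H_n) log v(H_n)) → ∞`. -/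
def IsDense (H : ∀ n, SimpleGraph (Fin (v n))) : Prop :=
  Tendsto v atTop atTop ∧
  Tendsto (fun n => (edgeCount (H n) : ℝ) / ((v n : ℝ) * Real.log (v n))) atTop atTop

/-- Delocalized: `α_q(H_n) ≤ α_0(H_n) + C / log n` with constants `0 < q ≤ 1` and `C`. -/
def IsDelocalized (H : ∀ n, SimpleGraph (Fin (v n))) : Prop :=
  ∃ q : ℝ, 0 < q ∧ q ≤ 1 ∧ ∃ C : ℝ, ∀ᶠ n : ℕ in atTop,
    alpha q (H n) ≤ alpha 0 (H n) + C / Real.log n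

/-- Almost balanced: `ψ_q(H_n) / ψ_{q'}(H_n) → 1` for all `q, q' ∈ (0, 1)`. -/
def IsAlmostBalanced (H : ∀ n, SimpleGraph (Fin (v n))) : Prop :=
  ∀ q ∈ Set.Ioo (0 : ℝ) 1, ∀ q' ∈ Set.Ioo (0 : ℝ) 1,
    Tendsto (fun n => psi n q (H n) / psi n q' (H n)) atTop (𝓝 1)

end PlantedSubgraph

end

/-! Given `Y`, the posterior is uniform on the copies of `H` contained in `Y`, so the MMSE is `e(H)`
minus the expected overlap of the planted copy with a posterior sample (`finiteMMSE_eq`). Everything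
reduces to two moment bounds on this overlap, in which a pair of copies is classified by its overlap
graph `I ⊆ H` and `ψ_q ^ e(I) * n ^ v(I)` stands for the first moment of `I` at `ψ_q`.

Above `ψ_q` (`le_mmse_of_psi_lt`): every `I` with at least `q e(H)` edges has first moment at least
`1` at `ψ_q`, so raising `p` by a constant factor makes pairs with such overlaps negligible in the
second moment. Hence at most about a fraction `q` of the edges is recoverable.

Below `ψ_q` (`mmse_le_of_lt_psi`): let `J` attain `ψ_q`. Every copy of `H` in `Y` contains a copy of
`J`, and a union bound excludes copies of `J` with fewer than `τ e(H)` planted edges, provided that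
the overlap graphs `I` with fewer than `τ e(H)` edges have first moment not much below `1`. Balance
gives this for `I` with a positive fraction of the edges; delocalization gives it for smaller `I`,
at a cost `exp(C e(I))`. Density makes all counting factors `exp(o(e(H)))`, against a gain `exp(-c
e(H))`.

Balance thus gives AoN at `ψ_{1/2}`. Conversely, AoN at `pc` forces `pc ≤ (1 + o(1)) ψ_q`, since
above `ψ_q` recovery is incomplete, and `pc ≥ (1 - o(1)) ψ_q`, since delocalization alone already
yields a positive fraction below `ψ_{q₁}` for a small `q₁ ≤ q`. So `pc / ψ_q → 1` for every `q`, and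
balance follows by taking quotients. -/

namespace PlantedSubgraph

open MeasureTheory ProbabilityTheory Filter Topology

/-! ### Posterior overlap and moment bounds for planted finite sets. -/

section FiniteModel

variable {E ι : Type*}

/-- The probability that a fixed set of `e` planted elements together with the random set
is equal to `y`, if `y` contains the planted set. -/
noncomputable def obsWeight (U : Finset E) (e : ℕ) (p : ℝ) (y : Finset E) : ℝ :=
  p ^ (y.card - e) * (1 - p) ^ (U.card - y.card)

lemma obsWeight_nonneg (U : Finset E) (e : ℕ) {p : ℝ} (h0 : 0 ≤ p) (h1 : p ≤ 1) (y : Finset E) :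
    0 ≤ obsWeight U e p y :=
  mul_nonneg (pow_nonneg h0 _) (pow_nonneg (sub_nonneg.2 h1) _)

variable [DecidableEq E]

lemma sum_Icc_binomial {A B : Finset E} (h : A ⊆ B) (p : ℝ) :
    ∑ y ∈ Finset.Icc A B, p ^ (y.card - A.card) * (1 - p) ^ (B.card - y.card) = 1 := by
  rw [Finset.Icc_eq_image_powerset h, Finset.sum_image]
  · have := Finset.sum_pow_mul_eq_add_pow p (1 - p) (B \ A)
    rw [show p + (1 - p) = 1 by ring, one_pow] at this
    refine Eq.trans (Finset.sum_congr rfl fun t ht => ?_) this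
    rw [Finset.mem_powerset] at ht
    have hd : Disjoint A t := (Finset.disjoint_sdiff).mono_right ht
    rw [Finset.card_union_of_disjoint hd, Finset.card_sdiff_of_subset h]
    congr 2 <;> omega
  · intro s hs t ht hst
    simp only [Finset.coe_powerset, Set.mem_preimage, Set.mem_powerset_iff, Finset.coe_subset] at hs ht
    have h1 : Disjoint s A := (Finset.disjoint_sdiff.mono_right hs).symm
    have h2 : Disjoint t A := (Finset.disjoint_sdiff.mono_right ht).symm
    have : A ∪ s = A ∪ t := hst
    rw [← Finset.union_sdiff_cancel_left h1.symm, this, Finset.union_sdiff_cancel_left h2.symm]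

/-- Used with `A = ed i` (total mass `1` of the observations with `i` planted), with `A` the union
of `ed i` and another set (the probability that this set appears too), and with `A = ∅`, `e = 0`
(the unplanted law). -/
lemma sum_obsWeight_supset {U A : Finset E} (hA : A ⊆ U) {e : ℕ} (he : e ≤ A.card) (p : ℝ) :
    ∑ y ∈ U.powerset with A ⊆ y, obsWeight U e p y = p ^ (A.card - e) := by
  have h : U.powerset.filter (A ⊆ ·) = Finset.Icc A U := by
    ext y; simp [Finset.mem_Icc, and_comm]
  rw [h, ← mul_one (p ^ (A.card - e)), ← sum_Icc_binomial hA p, Finset.mul_sum]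
  refine Finset.sum_congr rfl fun y hy => ?_
  rw [Finset.mem_Icc] at hy
  have := Finset.card_le_card hy.1
  rw [obsWeight, ← mul_assoc, ← pow_add]
  congr 2
  omega

/-- The random set must contain `y \ s` and is free on `s`. The result depends on `s` only through
its size, which is why the posterior is uniform. -/
lemma sum_union_eq {U s y : Finset E} (hs : s ⊆ y) (hy : y ⊆ U) (p : ℝ) :
    ∑ g ∈ U.powerset with s ∪ g = y, p ^ g.card * (1 - p) ^ (U.card - g.card)
      = obsWeight U s.card p y := by
  have h : U.powerset.filter (s ∪ · = y) = Finset.Icc (y \ s) y := by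
    ext g
    simp only [Finset.mem_filter, Finset.mem_powerset, Finset.mem_Icc]
    constructor
    · rintro ⟨-, rfl⟩
      exact ⟨by intro x; simp; tauto, Finset.subset_union_right⟩
    · rintro ⟨h1, h2⟩
      refine ⟨h2.trans hy, ?_⟩
      ext x
      have := @h1 x
      have := @h2 x
      have := @hs x
      simp only [Finset.mem_sdiff, Finset.mem_union] at *
      tauto
  conv_rhs => rw [← mul_one (obsWeight _ _ _ _),
    ← sum_Icc_binomial (Finset.sdiff_subset (s := y) (t := s)) p, Finset.mul_sum]
  rw [h]
  refine Finset.sum_congr rfl fun g hg => ?_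
  rw [Finset.mem_Icc] at hg
  have h1 := Finset.card_le_card hg.1
  have h2 := Finset.card_le_card hg.2
  have h3 := Finset.card_le_card hy
  rw [Finset.card_sdiff_of_subset hs] at *
  rw [obsWeight, mul_mul_mul_comm, ← pow_add, ← pow_add]
  congr 2 <;> omega

variable [Fintype ι]

/-- The (indices of the) planted sets contained in `y`. -/
def contained (ed : ι → Finset E) (y : Finset E) : Finset ι := Finset.univ.filter (ed · ⊆ y)

/-- The mean squared error of the posterior mean in the model with planted sets `ed i`,
for `i` uniform over `ι`, expressed through the uniform distribution on `contained ed y`. -/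
noncomputable def finiteMMSE (U : Finset E) (e : ℕ) (p : ℝ) (ed : ι → Finset E) : ℝ :=
  ∑ y ∈ U.powerset, obsWeight U e p y / Fintype.card ι *
    ∑ i ∈ contained ed y, ∑ x ∈ U, ((if x ∈ ed i then (1 : ℝ) else 0) -
      (∑ j ∈ contained ed y, if x ∈ ed j then (1 : ℝ) else 0) / (contained ed y).card) ^ 2

variable {U : Finset E} {e : ℕ} {ed : ι → Finset E}

/-- Since `0/1` coordinates equal their squares, each variance is a mean minus a squared mean;
summed over `x`, products of indicators become overlaps. -/
lemma sum_sq_sub_mean (hU : ∀ i, ed i ⊆ U) (he : ∀ i, (ed i).card = e) (y : Finset E) :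
    ∑ i ∈ contained ed y, ∑ x ∈ U, ((if x ∈ ed i then (1 : ℝ) else 0) -
      (∑ j ∈ contained ed y, if x ∈ ed j then (1 : ℝ) else 0) / (contained ed y).card) ^ 2
    = ∑ i ∈ contained ed y, ((e : ℝ) -
        (∑ j ∈ contained ed y, ((ed i ∩ ed j).card : ℝ)) / (contained ed y).card) := by
  set C := contained ed y
  rcases C.eq_empty_or_nonempty with hC | hC
  · simp [hC]
  have hZ : (C.card : ℝ) ≠ 0 := by exact_mod_cast hC.card_pos.ne'
  have h1 : ∀ i, (e : ℝ) = ∑ x ∈ U, (if x ∈ ed i then (1 : ℝ) else 0) := fun i => by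
    rw [Finset.sum_ite_mem, Finset.inter_eq_right.2 (hU i), ← he i]; simp
  have h2 : ∀ i j, ((ed i ∩ ed j).card : ℝ) = ∑ x ∈ U, (if x ∈ ed i then (1 : ℝ) else 0) *
      (if x ∈ ed j then (1 : ℝ) else 0) := fun i j => by
    have : ∀ x, (if x ∈ ed i then (1 : ℝ) else 0) * (if x ∈ ed j then (1 : ℝ) else 0)
      = if x ∈ ed i ∩ ed j then 1 else 0 := fun x => by
      by_cases a : x ∈ ed i <;> by_cases b : x ∈ ed j <;> simp [a, b]
    simp only [this]
    rw [Finset.sum_ite_mem, Finset.inter_eq_right.2 (Finset.inter_subset_left.trans (hU i))]; simp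
  rw [Finset.sum_comm (s := C)]
  have h3 : ∀ i ∈ C, (e : ℝ) - (∑ j ∈ C, ((ed i ∩ ed j).card : ℝ)) / C.card
      = ∑ x ∈ U, ((if x ∈ ed i then (1 : ℝ) else 0) - (if x ∈ ed i then (1 : ℝ) else 0) *
        (∑ j ∈ C, if x ∈ ed j then (1 : ℝ) else 0) / C.card) := fun i _ => by
    rw [Finset.sum_sub_distrib, ← h1 i]
    simp only [h2]
    rw [Finset.sum_comm, Finset.sum_div]
    simp only [Finset.mul_sum]
  rw [Finset.sum_congr rfl h3, Finset.sum_comm (s := C)]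
  refine Finset.sum_congr rfl fun x _ => ?_
  set a : ι → ℝ := fun i => if x ∈ ed i then (1 : ℝ) else 0
  have ha : ∀ i, a i ^ 2 = a i := fun i => by simp only [a]; split_ifs <;> simp
  change ∑ i ∈ C, (a i - (∑ j ∈ C, a j) / C.card) ^ 2
    = ∑ i ∈ C, (a i - a i * (∑ j ∈ C, a j) / C.card)
  set m := ∑ j ∈ C, a j with hm
  simp only [sub_sq, ha, Finset.sum_add_distrib, Finset.sum_sub_distrib, Finset.sum_const,
    nsmul_eq_mul, ← Finset.sum_mul, ← Finset.mul_sum, ← Finset.sum_div, ← hm]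
  field_simp
  ring

/-- Bayes' rule: drawing `y` and then `i` uniformly in `contained ed y` is the same as planting `i`
and then drawing `y`. -/
lemma sum_obsWeight_contained (p : ℝ)
    (f : ι → Finset E → ℝ) :
    ∑ y ∈ U.powerset, obsWeight U e p y / Fintype.card ι * ∑ i ∈ contained ed y, f i y
    = (∑ i, ∑ y ∈ U.powerset with ed i ⊆ y, obsWeight U e p y * f i y) / Fintype.card ι := by
  rw [Finset.sum_div]
  simp only [contained, Finset.sum_filter, Finset.mul_sum, Finset.sum_div]
  rw [Finset.sum_comm]
  refine Finset.sum_congr rfl fun i _ => Finset.sum_congr rfl fun y _ => ?_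
  split_ifs <;> ring

lemma finiteMMSE_eq [Nonempty ι] (hU : ∀ i, ed i ⊆ U) (he : ∀ i, (ed i).card = e) (p : ℝ) :
    finiteMMSE U e p ed = e - (∑ i, ∑ y ∈ U.powerset with ed i ⊆ y, obsWeight U e p y *
      ((∑ j ∈ contained ed y, ((ed i ∩ ed j).card : ℝ)) / (contained ed y).card))
        / Fintype.card ι := by
  have hM : (Fintype.card ι : ℝ) ≠ 0 := by exact_mod_cast Fintype.card_ne_zero
  rw [finiteMMSE, Finset.sum_congr rfl fun y _ => by rw [sum_sq_sub_mean hU he y],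
    sum_obsWeight_contained]
  simp only [mul_sub, Finset.sum_sub_distrib, ← Finset.sum_mul]
  have : ∀ i, ∑ y ∈ U.powerset with ed i ⊆ y, obsWeight U e p y = 1 := fun i => by
    rw [sum_obsWeight_supset (hU i) (he i).ge, he i]; simp
  simp only [this]
  rw [sub_div]
  simp [hM]

/-- If with high probability every planted set that is compatible with the observation has overlap
at least `t` with the planted one, then the mean squared error is at most `e - t`. -/
lemma finiteMMSE_le [Nonempty ι] (hU : ∀ i, ed i ⊆ U) (he : ∀ i, (ed i).card = e) {p : ℝ}
    (hp0 : 0 ≤ p) (hp1 : p ≤ 1) {κ : Type*} [Fintype κ] (td : κ → Finset E)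
    (hT : ∀ k, td k ⊆ U) {t B : ℝ} (ht : 0 ≤ t)
    (hκ : ∀ j, ∃ k, td k ⊆ ed j)
    (hB : ∀ i, ∑ k with ((td k ∩ ed i).card : ℝ) < t, p ^ (td k \ ed i).card ≤ B) :
    finiteMMSE U e p ed ≤ e - t * (1 - B) := by
  classical
  have hM : (0 : ℝ) < Fintype.card ι := by exact_mod_cast Fintype.card_pos
  rw [finiteMMSE_eq hU he]
  refine sub_le_sub_left ?_ _
  rw [le_div_iff₀ hM]
  have key : ∀ i, t * (1 - B) ≤ ∑ y ∈ U.powerset with ed i ⊆ y, obsWeight U e p y *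
      ((∑ j ∈ contained ed y, ((ed i ∩ ed j).card : ℝ)) / (contained ed y).card) := fun i => by
    have h1 : ∑ y ∈ U.powerset with ed i ⊆ y, obsWeight U e p y = 1 := by
      rw [sum_obsWeight_supset (hU i) (he i).ge, he i]; simp
    set K := Finset.univ.filter (fun k => ((td k ∩ ed i).card : ℝ) < t)
    have h2 : ∀ y ∈ U.powerset.filter (ed i ⊆ ·), obsWeight U e p y *
        (t - t * ∑ k ∈ K, if td k ⊆ y then 1 else 0) ≤ obsWeight U e p y *
      ((∑ j ∈ contained ed y, ((ed i ∩ ed j).card : ℝ)) / (contained ed y).card) := by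
      intro y hy
      rw [Finset.mem_filter] at hy
      refine mul_le_mul_of_nonneg_left ?_ (obsWeight_nonneg U e hp0 hp1 y)
      have hi : i ∈ contained ed y := by simp [contained, hy.2]
      have hZ : (0 : ℝ) < (contained ed y).card := by exact_mod_cast Finset.card_pos.2 ⟨i, hi⟩
      by_cases hbad : ∃ k ∈ K, td k ⊆ y
      · obtain ⟨k, hk, hky⟩ := hbad
        have : (1 : ℝ) ≤ ∑ k ∈ K, if td k ⊆ y then (1 : ℝ) else 0 := by
          refine le_trans ?_ (Finset.single_le_sum (f := fun k => if td k ⊆ y then (1 : ℝ) else 0)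
            (fun k _ => by positivity) hk)
          simp [hky]
        have : t * 1 ≤ t * ∑ k ∈ K, if td k ⊆ y then (1 : ℝ) else 0 :=
          mul_le_mul_of_nonneg_left this ht
        have : 0 ≤ (∑ j ∈ contained ed y, ((ed i ∩ ed j).card : ℝ)) / (contained ed y).card := by
          positivity
        linarith
      · push Not at hbad
        have : ∑ k ∈ K, (if td k ⊆ y then (1 : ℝ) else 0) = 0 :=
          Finset.sum_eq_zero fun k hk => by simp [hbad k hk]
        rw [this, mul_zero, sub_zero, le_div_iff₀ hZ, mul_comm, ← nsmul_eq_mul]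
        refine Finset.card_nsmul_le_sum _ _ _ fun j hj => ?_
        obtain ⟨k, hk⟩ := hκ j
        have hjy : ed j ⊆ y := by simpa [contained] using hj
        have hkK : k ∉ K := fun hkK => hbad k hkK (hk.trans hjy)
        simp only [K, Finset.mem_filter, Finset.mem_univ, true_and, not_lt] at hkK
        refine hkK.trans ?_
        rw [Finset.inter_comm]
        exact_mod_cast Finset.card_le_card (Finset.inter_subset_inter_left hk)
    refine le_trans ?_ (Finset.sum_le_sum h2)
    simp only [mul_sub, Finset.sum_sub_distrib, ← Finset.sum_mul, h1, one_mul, mul_one]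
    have h3 : ∑ y ∈ U.powerset with ed i ⊆ y, obsWeight U e p y *
        (t * ∑ k ∈ K, if td k ⊆ y then 1 else 0) = t * ∑ k ∈ K, p ^ (td k \ ed i).card := by
      simp only [Finset.mul_sum]
      rw [Finset.sum_comm]
      refine Finset.sum_congr rfl fun k _ => ?_
      have h4 := sum_obsWeight_supset (U := U) (A := ed i ∪ td k)
        (Finset.union_subset (hU i) (hT k)) (e := e)
        ((he i).ge.trans (Finset.card_le_card Finset.subset_union_left)) p
      have h5 : (ed i ∪ td k).card - e = (td k \ ed i).card := by
        rw [← Finset.union_sdiff_self_eq_union, Finset.card_union_of_disjoint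
          Finset.disjoint_sdiff, he i]
        omega
      rw [← h5, ← h4, Finset.mul_sum]
      simp only [Finset.union_subset_iff, ← Finset.filter_filter]
      rw [Finset.sum_filter (fun y => td k ⊆ y)]
      refine Finset.sum_congr rfl fun y _ => ?_
      split_ifs <;> ring
    rw [h3]
    exact sub_le_sub_left (mul_le_mul_of_nonneg_left (hB i) ht) _
  calc t * (1 - B) * Fintype.card ι = ∑ _i : ι, t * (1 - B) := by
        rw [Finset.sum_const, nsmul_eq_mul, Finset.card_univ]; ring
    _ ≤ _ := Finset.sum_le_sum fun i _ => key i

/-- If pairs of planted sets with overlap at least `t` contribute little to the second moment of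
the number of planted sets in the random set, then the mean squared error is almost `e - t`. -/
lemma le_finiteMMSE [Nonempty ι] (hU : ∀ i, ed i ⊆ U) (he : ∀ i, (ed i).card = e) {p : ℝ}
    (hp0 : 0 < p) (hp1 : p ≤ 1) {t b : ℝ} (ht : 0 ≤ t) (hb : 0 < b)
    (hB : ∀ i, ∑ j with t ≤ ((ed i ∩ ed j).card : ℝ), (p⁻¹) ^ (ed i ∩ ed j).card
      ≤ Fintype.card ι * b ^ 2) :
    e - t - 2 * e * b ≤ finiteMMSE U e p ed := by
  classical
  have hM : (0 : ℝ) < Fintype.card ι := by exact_mod_cast Fintype.card_pos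
  rw [finiteMMSE_eq hU he]
  rw [sub_sub]
  refine sub_le_sub_left ?_ _
  rw [div_le_iff₀ hM]
  -- `τ` is `b` times the expected number of planted sets inside a purely random set.
  set τ : ℝ := b * Fintype.card ι * p ^ e with hτ
  have hτ0 : 0 < τ := by positivity
  have hsum1 : ∀ i, ∑ y ∈ U.powerset with ed i ⊆ y, obsWeight U e p y = 1 := fun i => by
    rw [sum_obsWeight_supset (hU i) (he i).ge, he i]; simp
  -- pointwise bound of the average overlap
  have hpt : ∀ i, ∀ y ∈ U.powerset.filter (ed i ⊆ ·), obsWeight U e p y *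
      ((∑ j ∈ contained ed y, ((ed i ∩ ed j).card : ℝ)) / (contained ed y).card)
      ≤ obsWeight U e p y * (t + e * (if ((contained ed y).card : ℝ) < τ then 1 else 0)
        + e / τ * ∑ j with t ≤ ((ed i ∩ ed j).card : ℝ), if ed j ⊆ y then (1 : ℝ) else 0) := by
    intro i y hy
    rw [Finset.mem_filter] at hy
    refine mul_le_mul_of_nonneg_left ?_ (obsWeight_nonneg U e hp0.le hp1 y)
    have hi : i ∈ contained ed y := by simp [contained, hy.2]
    have hZ : (0 : ℝ) < (contained ed y).card := by exact_mod_cast Finset.card_pos.2 ⟨i, hi⟩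
    have hle : ∀ j, ((ed i ∩ ed j).card : ℝ) ≤ e := fun j => by
      rw [← he i]; exact_mod_cast Finset.card_le_card Finset.inter_subset_left
    split_ifs with hlt
    · have : (∑ j ∈ contained ed y, ((ed i ∩ ed j).card : ℝ)) / (contained ed y).card ≤ e := by
        rw [div_le_iff₀ hZ, mul_comm, ← nsmul_eq_mul]
        exact Finset.sum_le_card_nsmul _ _ _ fun j _ => hle j
      have h2 : 0 ≤ e / τ * ∑ j with t ≤ ((ed i ∩ ed j).card : ℝ),
        if ed j ⊆ y then (1 : ℝ) else 0 := by positivity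
      linarith
    · rw [mul_zero, add_zero]
      have h1 : ∑ j ∈ contained ed y, ((ed i ∩ ed j).card : ℝ) ≤ ∑ j ∈ contained ed y,
          (t + e * if t ≤ ((ed i ∩ ed j).card : ℝ) then 1 else 0) :=
        Finset.sum_le_sum fun j _ => by
          have := hle j
          split_ifs with h <;> linarith
      rw [Finset.sum_add_distrib, Finset.sum_const, nsmul_eq_mul, ← Finset.mul_sum] at h1
      have h2 : ∑ j ∈ contained ed y, (if t ≤ ((ed i ∩ ed j).card : ℝ) then (1 : ℝ) else 0)
          = ∑ j with t ≤ ((ed i ∩ ed j).card : ℝ), if ed j ⊆ y then (1 : ℝ) else 0 := by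
        rw [contained, Finset.sum_filter, Finset.sum_filter]
        refine Finset.sum_congr rfl fun j _ => ?_
        split_ifs <;> rfl
      rw [h2] at h1
      set S := ∑ j with t ≤ ((ed i ∩ ed j).card : ℝ), if ed j ⊆ y then (1 : ℝ) else 0
      have hS : 0 ≤ S := by positivity
      rw [div_le_iff₀ hZ]
      refine h1.trans ?_
      rw [add_mul, mul_comm t]
      refine add_le_add (le_of_eq rfl) ?_
      rw [div_mul_eq_mul_div, div_mul_eq_mul_div, le_div_iff₀ hτ0]
      exact mul_le_mul_of_nonneg_left (not_lt.1 hlt) (by positivity)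
  -- few planted sets
  have hfew : ∑ i, ∑ y ∈ U.powerset with ed i ⊆ y, obsWeight U e p y *
      (if ((contained ed y).card : ℝ) < τ then (1 : ℝ) else 0) ≤ b * Fintype.card ι := by
    have h := sum_obsWeight_contained (U := U) (e := e) (ed := ed) p
      (fun _ y => if ((contained ed y).card : ℝ) < τ then (1 : ℝ) else 0)
    rw [eq_div_iff hM.ne'] at h
    rw [← h]
    refine mul_le_mul_of_nonneg_right ?_ hM.le
    have hpe : 0 < p ^ e := by positivity
    have h3 : ∑ y ∈ U.powerset with e ≤ y.card, obsWeight U e p y * p ^ e ≤ 1 := by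
      have h4 := sum_obsWeight_supset (Finset.empty_subset U) (le_refl 0) p
      simp only [Finset.empty_subset, Finset.filter_true, Finset.card_empty, tsub_zero,
        pow_zero] at h4
      rw [← h4]
      refine le_trans (Finset.sum_le_sum fun y hy => ?_) (Finset.sum_le_sum_of_subset_of_nonneg
        (Finset.filter_subset _ _) fun y _ _ => obsWeight_nonneg U 0 hp0.le hp1 y)
      rw [Finset.mem_filter] at hy
      rw [obsWeight, obsWeight, mul_right_comm, ← pow_add, Nat.sub_add_cancel hy.2, tsub_zero]
    -- The planted law is size-biased: its density against the unplanted law is the number of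
    -- contained sets over its mean. Where that number is below `τ`, the density is at most `b`.
    have h5 : ∀ y ∈ U.powerset, obsWeight U e p y / Fintype.card ι *
        ∑ i ∈ contained ed y, (if ((contained ed y).card : ℝ) < τ then (1 : ℝ) else 0)
        ≤ if e ≤ y.card then b * (obsWeight U e p y * p ^ e) else 0 := by
      intro y _
      rcases (contained ed y).eq_empty_or_nonempty with hC | ⟨i, hi⟩
      · rw [hC, Finset.sum_empty, mul_zero]
        have := obsWeight_nonneg U e hp0.le hp1 y
        split_ifs <;> positivity
      · have hey : e ≤ y.card := by
          rw [← he i]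
          exact Finset.card_le_card (by simpa [contained] using hi)
        rw [if_pos hey, Finset.sum_const, nsmul_eq_mul]
        have hw := obsWeight_nonneg U e hp0.le hp1 y
        have h6 : ((contained ed y).card : ℝ) *
            (if ((contained ed y).card : ℝ) < τ then (1 : ℝ) else 0) ≤ τ := by
          split_ifs with h
          · linarith
          · linarith
        calc obsWeight U e p y / Fintype.card ι * _ ≤ obsWeight U e p y / Fintype.card ι * τ :=
              mul_le_mul_of_nonneg_left h6 (by positivity)
          _ = _ := by rw [hτ]; field_simp
    refine (Finset.sum_le_sum h5).trans ?_
    rw [← Finset.sum_filter, ← Finset.mul_sum]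
    exact mul_le_of_le_one_right hb.le h3
  -- pairs with large overlap
  have hpair : ∀ i, ∑ y ∈ U.powerset with ed i ⊆ y, obsWeight U e p y *
      ∑ j with t ≤ ((ed i ∩ ed j).card : ℝ), (if ed j ⊆ y then (1 : ℝ) else 0) ≤ b * τ := by
    intro i
    simp only [Finset.mul_sum]
    rw [Finset.sum_comm]
    have : ∀ j, ∑ y ∈ U.powerset with ed i ⊆ y, obsWeight U e p y *
        (if ed j ⊆ y then (1 : ℝ) else 0) = p ^ e * (p⁻¹) ^ (ed i ∩ ed j).card := fun j => by
      have h4 := sum_obsWeight_supset (U := U) (A := ed i ∪ ed j)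
        (Finset.union_subset (hU i) (hU j)) (e := e)
        ((he i).ge.trans (Finset.card_le_card Finset.subset_union_left)) p
      have h5 := Finset.card_union_add_card_inter (ed i) (ed j)
      have h6 : (ed i ∩ ed j).card ≤ e := by
        rw [← he i]; exact Finset.card_le_card Finset.inter_subset_left
      rw [he i, he j] at h5
      have h7 : (ed i ∪ ed j).card - e = e - (ed i ∩ ed j).card := by omega
      rw [inv_pow, ← pow_sub₀ _ hp0.ne' h6, ← h7, ← h4]
      simp only [Finset.union_subset_iff, ← Finset.filter_filter]
      rw [Finset.sum_filter (fun y => ed j ⊆ y)]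
      refine Finset.sum_congr rfl fun y _ => ?_
      split_ifs <;> ring
    simp only [this, ← Finset.mul_sum]
    calc _ ≤ p ^ e * (Fintype.card ι * b ^ 2) := mul_le_mul_of_nonneg_left (hB i) (by positivity)
      _ = b * τ := by rw [hτ]; ring
  calc _ ≤ ∑ i, ∑ y ∈ U.powerset with ed i ⊆ y, obsWeight U e p y *
      (t + e * (if ((contained ed y).card : ℝ) < τ then 1 else 0)
        + e / τ * ∑ j with t ≤ ((ed i ∩ ed j).card : ℝ), if ed j ⊆ y then (1 : ℝ) else 0) :=
      Finset.sum_le_sum fun i _ => Finset.sum_le_sum (hpt i)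
    _ = t * Fintype.card ι + e * (∑ i, ∑ y ∈ U.powerset with ed i ⊆ y, obsWeight U e p y *
          (if ((contained ed y).card : ℝ) < τ then (1 : ℝ) else 0)) + e / τ *
          (∑ i, ∑ y ∈ U.powerset with ed i ⊆ y, obsWeight U e p y *
            ∑ j with t ≤ ((ed i ∩ ed j).card : ℝ), (if ed j ⊆ y then (1 : ℝ) else 0)) := by
        simp only [mul_add, Finset.sum_add_distrib, ← Finset.sum_mul, hsum1]
        congr 1
        · congr 1
          · simp; ring
          · simp only [Finset.mul_sum]
            refine Finset.sum_congr rfl fun i _ => Finset.sum_congr rfl fun y _ => by ring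
        · rw [Finset.mul_sum]
          refine Finset.sum_congr rfl fun i _ => ?_
          rw [Finset.mul_sum]
          refine Finset.sum_congr rfl fun y _ => by ring
    _ ≤ t * Fintype.card ι + e * (b * Fintype.card ι) + e / τ * (Fintype.card ι * (b * τ)) := by
        gcongr
        calc _ ≤ ∑ _i : ι, b * τ := Finset.sum_le_sum fun i _ => hpair i
          _ = _ := by simp
    _ = (t + 2 * e * b) * Fintype.card ι := by field_simp; ring

end FiniteModel

/-! ### From the measure-theoretic model to sums over edge sets. -/

section Bridge

open scoped Classical in
/-- The edges of a subgraph of `K_n` as a finite set. -/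
noncomputable def edges {n : ℕ} (S : (⊤ : SimpleGraph (Fin n)).Subgraph) : Finset (Sym2 (Fin n)) :=
  S.edgeSet.toFinset

/-- The edges of `K_n`. -/
noncomputable def allEdges (n : ℕ) : Finset (Sym2 (Fin n)) := (⊤ : SimpleGraph (Fin n)).edgeFinset

lemma mem_edges {n : ℕ} {S : (⊤ : SimpleGraph (Fin n)).Subgraph} {x : Sym2 (Fin n)} :
    x ∈ edges S ↔ x ∈ S.edgeSet := by simp [edges]

lemma edges_subset {n : ℕ} (S : (⊤ : SimpleGraph (Fin n)).Subgraph) : edges S ⊆ allEdges n := by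
  intro x hx
  rw [allEdges, SimpleGraph.mem_edgeFinset]
  exact S.edgeSet_subset (mem_edges.1 hx)

lemma card_edges {n : ℕ} (S : (⊤ : SimpleGraph (Fin n)).Subgraph) :
    (edges S).card = S.edgeSet.ncard := by
  rw [← Set.ncard_coe_finset]; congr 1; ext x; simp [mem_edges]

lemma card_allEdges (n : ℕ) : (allEdges n).card = n.choose 2 := by
  rw [allEdges, SimpleGraph.card_edgeFinset_top_eq_card_choose_two, Fintype.card_fin]

lemma sum_simpleGraph {n : ℕ} (f : Finset (Sym2 (Fin n)) → ℝ) :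
    ∑ G : SimpleGraph (Fin n), f (Set.toFinite G.edgeSet).toFinset
      = ∑ y ∈ (allEdges n).powerset, f y := by
  classical
  refine Finset.sum_bij' (fun G _ => (Set.toFinite G.edgeSet).toFinset)
    (fun y _ => SimpleGraph.fromEdgeSet (y : Set (Sym2 (Fin n)))) ?_ ?_ ?_ ?_ ?_
  · intro G _
    rw [Finset.mem_powerset]
    intro x hx
    rw [allEdges, SimpleGraph.mem_edgeFinset]
    exact SimpleGraph.edgeSet_mono le_top (by simpa using hx)
  · simp
  · intro G _
    simp
  · intro y hy
    rw [Finset.mem_powerset] at hy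
    ext x
    simp only [Set.Finite.mem_toFinset, SimpleGraph.edgeSet_fromEdgeSet, Set.mem_sdiff,
      Finset.mem_coe, and_iff_left_iff_imp]
    intro hx
    have := hy hx
    rw [allEdges, SimpleGraph.mem_edgeFinset] at this
    exact SimpleGraph.not_isDiag_of_mem_edgeSet _ this
  · intro G _
    rfl

variable {n k : ℕ} {H : SimpleGraph (Fin k)} (p : unitInterval)

lemma edgeSet_ncard_of_mem_copies {S : (⊤ : SimpleGraph (Fin n)).Subgraph} (hS : S ∈ copies n H) :
    (edges S).card = edgeCount H := by
  obtain ⟨φ⟩ := hS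
  rw [card_edges, ← SimpleGraph.Subgraph.image_coe_edgeSet_coe,
    Set.ncard_image_of_injective _ (Sym2.map.injective Subtype.val_injective), edgeCount,
    ← Nat.card_coe_set_eq, ← Nat.card_coe_set_eq]
  exact (Nat.card_congr φ.mapEdgeSet).symm

noncomputable instance : Fintype (⊤ : SimpleGraph (Fin n)).Subgraph := Fintype.ofFinite _
noncomputable instance : Fintype (copies n H) := Fintype.ofFinite _

instance : MeasurableSingletonClass (⊤ : SimpleGraph (Fin n)).Subgraph := ⟨fun _ => trivial⟩

instance : MeasurableSingletonClass (SimpleGraph (Fin n)) where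
  measurableSet_singleton G := ⟨{G.Adj}, (Set.toFinite _).measurableSet, by
    ext G'; exact SimpleGraph.adj_inj⟩

lemma uniformOn_real_singleton {Ω : Type*} [MeasurableSpace Ω] [MeasurableSingletonClass Ω]
    (s : Set Ω) [Fintype s] (x : Ω) :
    (uniformOn s).real {x} = s.indicator (fun _ => (1 : ℝ)) x / Fintype.card s := by
  classical
  have h : uniformOn s {x} = ((s.toFinset ∩ {x}).card : ENNReal) / s.toFinset.card := by
    rw [← uniformOn_apply_finset]; simp
  rw [measureReal_def, h, ENNReal.toReal_div, Set.toFinset_card]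
  by_cases hx : x ∈ s
  · rw [Finset.inter_singleton_of_mem (by simpa using hx)]; simp [hx]
  · rw [Finset.inter_singleton_of_notMem (by simpa using hx)]; simp [hx]

lemma plantedLaw_real_singleton (S : (⊤ : SimpleGraph (Fin n)).Subgraph) (G : SimpleGraph (Fin n)) :
    (plantedLaw n H p).real {(S, G)} =
      (copies n H).indicator (fun _ => (1 : ℝ)) S / Fintype.card (copies n H) *
        ((p : ℝ) ^ G.edgeSet.ncard * (1 - p : ℝ) ^ ((allEdges n).card - G.edgeSet.ncard)) := by
  classical
  rw [plantedLaw, ← Set.singleton_prod_singleton, measureReal_prod_prod]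
  congr 1
  · exact uniformOn_real_singleton _ _
  · rw [measureReal_def, SimpleGraph.binomialRandom_singleton, card_allEdges]
    simp

lemma integral_plantedLaw
    (f : (⊤ : SimpleGraph (Fin n)).Subgraph → SimpleGraph (Fin n) → ℝ) :
    ∫ ω, f ω.1 (observation ω) ∂(plantedLaw n H p) =
      (∑ S : copies n H, ∑ y ∈ (allEdges n).powerset with edges S.1 ⊆ y,
        obsWeight (allEdges n) (edgeCount H) p y * f S.1 (SimpleGraph.fromEdgeSet (y : Set _))) /
        Fintype.card (copies n H) := by
  have : IsFiniteMeasure (plantedLaw n H p) := by unfold plantedLaw; infer_instance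
  rw [integral_fintype (Integrable.of_finite), Fintype.sum_prod_type, Finset.sum_div]
  simp only [plantedLaw_real_singleton, smul_eq_mul]
  have hsub : ∀ F : (⊤ : SimpleGraph (Fin n)).Subgraph → ℝ, ∑ S : copies n H, F S.1
      = ∑ S, (copies n H).indicator F S := fun F => by
    rw [← Finset.sum_subset (Finset.subset_univ (copies n H).toFinset)]
    · rw [← Finset.sum_subtype (copies n H).toFinset (by simp) ]
      exact Finset.sum_congr rfl fun S hS => by simp at hS; simp [hS]
    · intro S _ hS
      simp at hS
      simp [hS]
  rw [hsub fun S => (∑ y ∈ (allEdges n).powerset with edges S ⊆ y,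
    obsWeight (allEdges n) (edgeCount H) p y * f S (SimpleGraph.fromEdgeSet (y : Set _))) /
        Fintype.card (copies n H)]
  refine Finset.sum_congr rfl fun S _ => ?_
  by_cases hS : S ∈ copies n H
  swap
  · simp [hS]
  simp only [Set.indicator_of_mem hS]
  simp only [one_div, mul_assoc, ← Finset.mul_sum]
  rw [div_eq_inv_mul]
  congr 1
  have h1 : ∀ G : SimpleGraph (Fin n), (p : ℝ) ^ G.edgeSet.ncard *
      ((1 - p : ℝ) ^ ((allEdges n).card - G.edgeSet.ncard) * f S (observation (S, G))) =
      (fun g : Finset (Sym2 (Fin n)) => (p : ℝ) ^ g.card *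
        (1 - p : ℝ) ^ ((allEdges n).card - g.card) *
        f S (SimpleGraph.fromEdgeSet ((edges S ∪ g : Finset _) : Set _)))
        (Set.toFinite G.edgeSet).toFinset := fun G => by
    have : observation (S, G) = SimpleGraph.fromEdgeSet
        ((edges S ∪ (Set.toFinite G.edgeSet).toFinset : Finset _) : Set _) := by
      have e1 : ((edges S : Finset _) : Set (Sym2 (Fin n))) = S.spanningCoe.edgeSet := by
        ext x; simp [mem_edges]
      rw [observation, Finset.coe_union, Set.Finite.coe_toFinset, SimpleGraph.fromEdgeSet_union, e1,
        SimpleGraph.fromEdgeSet_edgeSet, SimpleGraph.fromEdgeSet_edgeSet]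
    simp only [this, Set.ncard_eq_toFinset_card G.edgeSet]
    ring
  rw [Finset.sum_congr rfl fun G _ => h1 G, sum_simpleGraph fun g => (p : ℝ) ^ g.card *
        (1 - p : ℝ) ^ ((allEdges n).card - g.card) *
        f S (SimpleGraph.fromEdgeSet ((edges S ∪ g : Finset _) : Set _))]
  have hmaps : ∀ g ∈ (allEdges n).powerset, edges S ∪ g ∈
      (allEdges n).powerset.filter (edges S ⊆ ·) := fun g hg => by
    rw [Finset.mem_powerset] at hg
    simp [Finset.union_subset (edges_subset S) hg, Finset.subset_union_left]
  rw [← Finset.sum_fiberwise_of_maps_to hmaps]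
  refine Finset.sum_congr rfl fun y hy => ?_
  rw [Finset.mem_filter, Finset.mem_powerset] at hy
  rw [← edgeSet_ncard_of_mem_copies hS, ← sum_union_eq hy.2 hy.1, Finset.sum_mul]
  refine Finset.sum_congr rfl fun g hg => ?_
  rw [Finset.mem_filter] at hg
  rw [hg.2]

lemma integral_cond {Ω : Type*} [MeasurableSpace Ω] (μ : Measure Ω) {A : Set Ω}
    (hA : MeasurableSet A) (f : Ω → ℝ) :
    ∫ ω, f ω ∂(ProbabilityTheory.cond μ A) = (∫ ω, A.indicator f ω ∂μ) / ∫ ω, A.indicator 1 ω ∂μ := by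
  rw [ProbabilityTheory.cond, integral_smul_measure, integral_indicator hA, integral_indicator_one hA,
    ENNReal.toReal_inv, smul_eq_mul, div_eq_inv_mul, measureReal_def]

/-- All copies inside `y` have the same joint weight with `y`; this common factor cancels in the
conditional expectation. -/
lemma posteriorMean_fromEdgeSet (e : Sym2 (Fin n)) {y : Finset (Sym2 (Fin n))}
    (hy : y ⊆ allEdges n) (hw : obsWeight (allEdges n) (edgeCount H) p y ≠ 0)
    (hc : Fintype.card (copies n H) ≠ 0) :
    posteriorMean n H p e (SimpleGraph.fromEdgeSet (y : Set _)) =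
      (∑ S ∈ contained (fun S : copies n H => edges S.1) y,
        if e ∈ edges S.1 then (1 : ℝ) else 0) /
        (contained (fun S : copies n H => edges S.1) y).card := by
  classical
  have hinj : ∀ z ⊆ allEdges n, (SimpleGraph.fromEdgeSet (z : Set (Sym2 (Fin n))) =
      SimpleGraph.fromEdgeSet (y : Set (Sym2 (Fin n))) ↔ z = y) := by
    have h0 : ∀ z ⊆ allEdges n, (SimpleGraph.fromEdgeSet (z : Set (Sym2 (Fin n)))).edgeSet = z := by
      intro z hz
      ext x
      simp only [SimpleGraph.edgeSet_fromEdgeSet, Set.mem_sdiff, Finset.mem_coe,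
        and_iff_left_iff_imp]
      intro hx
      have := hz hx
      rw [allEdges, SimpleGraph.mem_edgeFinset] at this
      exact SimpleGraph.not_isDiag_of_mem_edgeSet _ this
    intro z hz
    refine ⟨fun h => ?_, fun h => by rw [h]⟩
    have := congrArg SimpleGraph.edgeSet h
    rw [h0 z hz, h0 y hy] at this
    exact_mod_cast this
  have hfac : ∀ g : (⊤ : SimpleGraph (Fin n)).Subgraph → ℝ,
      ∫ ω, (observation ⁻¹' {SimpleGraph.fromEdgeSet (y : Set (Sym2 (Fin n)))}).indicator
        (fun ω => g ω.1) ω ∂(plantedLaw n H p) =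
      obsWeight (allEdges n) (edgeCount H) p y / Fintype.card (copies n H) *
        ∑ S ∈ contained (fun S : copies n H => edges S.1) y, g S.1 := fun g => by
    have h1 : ∀ ω : (⊤ : SimpleGraph (Fin n)).Subgraph × SimpleGraph (Fin n),
        (observation ⁻¹' {SimpleGraph.fromEdgeSet (y : Set (Sym2 (Fin n)))}).indicator
        (fun ω => g ω.1) ω = (fun S Y => if Y = SimpleGraph.fromEdgeSet (y : Set (Sym2 (Fin n)))
          then g S else 0) ω.1 (observation ω) := fun ω => by
      simp [Set.indicator_apply]
    simp only [h1]
    rw [integral_plantedLaw p (fun S Y => if Y = SimpleGraph.fromEdgeSet (y : Set (Sym2 (Fin n)))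
          then g S else 0), div_mul_eq_mul_div]
    congr 1
    rw [contained, Finset.sum_filter, Finset.mul_sum]
    refine Finset.sum_congr rfl fun S _ => ?_
    rw [Finset.sum_filter, Finset.sum_eq_single_of_mem y (Finset.mem_powerset.2 hy)]
    · rw [if_pos rfl]; split_ifs <;> simp
    · intro z hz hzy
      rw [Finset.mem_powerset] at hz
      simp [hinj z hz, hzy]
  rw [posteriorMean, integral_cond _ (Set.toFinite _).measurableSet]
  have h1 : (signal e : (⊤ : SimpleGraph (Fin n)).Subgraph × SimpleGraph (Fin n) → ℝ) =
      fun ω => (fun S : (⊤ : SimpleGraph (Fin n)).Subgraph =>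
        if e ∈ edges S then (1 : ℝ) else 0) ω.1 := by
    funext ω
    simp [signal, Set.indicator_apply, mem_edges]
  have h2 : (1 : (⊤ : SimpleGraph (Fin n)).Subgraph × SimpleGraph (Fin n) → ℝ) =
      fun ω => (fun _ : (⊤ : SimpleGraph (Fin n)).Subgraph => (1 : ℝ)) ω.1 := rfl
  rw [h1, h2, hfac fun S => if e ∈ edges S then (1 : ℝ) else 0, hfac fun _ => 1]
  have : (Fintype.card (copies n H) : ℝ) ≠ 0 := by exact_mod_cast hc
  rw [mul_div_mul_left _ _ (div_ne_zero hw this)]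
  simp

/-- The mean squared error of the planted model is that of the posterior sampling on finite sets. -/
theorem mmse_eq_finiteMMSE (hne : (copies n H).Nonempty) :
    mmse n H p = finiteMMSE (allEdges n) (edgeCount H) p (fun S : copies n H => edges S.1) := by
  classical
  have hc : Fintype.card (copies n H) ≠ 0 := by
    have := hne.to_subtype
    exact Fintype.card_ne_zero
  have h1 : ∀ ω : (⊤ : SimpleGraph (Fin n)).Subgraph × SimpleGraph (Fin n),
      ∑ e ∈ (⊤ : SimpleGraph (Fin n)).edgeFinset,
        (signal e ω - posteriorMean n H p e (observation ω)) ^ 2 =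
      (fun S Y => ∑ e ∈ allEdges n, ((if e ∈ edges S then (1 : ℝ) else 0) -
        posteriorMean n H p e Y) ^ 2) ω.1 (observation ω) := fun ω => by
    simp [signal, Set.indicator_apply, mem_edges, allEdges]
  rw [mmse]
  simp only [h1]
  rw [integral_plantedLaw p (fun S Y => ∑ e ∈ allEdges n, ((if e ∈ edges S then (1 : ℝ) else 0) -
        posteriorMean n H p e Y) ^ 2), finiteMMSE, ← sum_obsWeight_contained (ed := fun S :
          copies n H => edges S.1) (p : ℝ) (fun S y => ∑ e ∈ allEdges n,
            ((if e ∈ edges S.1 then (1 : ℝ) else 0) - posteriorMean n H p e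
              (SimpleGraph.fromEdgeSet (y : Set _))) ^ 2)]
  refine Finset.sum_congr rfl fun y hy => ?_
  -- The posterior formula needs a nonzero weight; a zero weight (possible for `p = 0` or `p = 1`)
  -- kills the term on both sides.
  by_cases hw : obsWeight (allEdges n) (edgeCount H) p y = 0
  · rw [hw]; simp
  · congr 1
    refine Finset.sum_congr rfl fun S _ => Finset.sum_congr rfl fun e _ => ?_
    rw [posteriorMean_fromEdgeSet p e (Finset.mem_powerset.1 hy) hw hc]

end Bridge

/-! ### Counting copies and their overlaps with a fixed copy. -/

section Counting

/-- In the induction, `(n + 1) * n.choose k = (n + 1).choose (k + 1) * (k + 1)`, and `(n + 1) / (k +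
1) ≤ n / k` because `k ≤ n`. -/
lemma pow_le_choose_mul_pow {n k : ℕ} (h : k ≤ n) : n ^ k ≤ n.choose k * k ^ k := by
  induction k generalizing n with
  | zero => simp
  | succ k ih =>
    obtain ⟨n, rfl⟩ : ∃ m, n = m + 1 := ⟨n - 1, by omega⟩
    have hk : k ≤ n := by omega
    have h1 : (n + 1) ^ k ≤ n.choose k * (k + 1) ^ k := by
      rcases k.eq_zero_or_pos with rfl | hk0
      · simp
      refine Nat.le_of_mul_le_mul_right (c := k ^ k) ?_ (by positivity)
      calc (n + 1) ^ k * k ^ k = ((n + 1) * k) ^ k := (mul_pow _ _ _).symm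
        _ ≤ (n * (k + 1)) ^ k := Nat.pow_le_pow_left (by nlinarith) _
        _ = n ^ k * (k + 1) ^ k := mul_pow _ _ _
        _ ≤ n.choose k * k ^ k * (k + 1) ^ k := Nat.mul_le_mul_right _ (ih hk)
        _ = _ := by ring
    calc (n + 1) ^ (k + 1) = (n + 1) * (n + 1) ^ k := by ring
      _ ≤ (n + 1) * (n.choose k * (k + 1) ^ k) := Nat.mul_le_mul_left _ h1
      _ = ((n + 1) * n.choose k) * (k + 1) ^ k := by ring
      _ = _ := by rw [Nat.add_one_mul_choose_eq]; ring

variable {n : ℕ} {W : Type*}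

/-- The copy of `J` in `K_n` given by an injection of the vertices. -/
def copyOf (J : SimpleGraph W) (φ : W ↪ Fin n) : (⊤ : SimpleGraph (Fin n)).Subgraph where
  verts := Set.range φ
  Adj a b := ∃ x y, J.Adj x y ∧ φ x = a ∧ φ y = b
  adj_sub := by
    rintro a b ⟨x, y, h, rfl, rfl⟩
    simpa using h.ne
  edge_vert := by
    rintro a b ⟨x, y, h, rfl, rfl⟩
    exact ⟨x, rfl⟩
  symm := ⟨by
    rintro a b ⟨x, y, h, rfl, rfl⟩
    exact ⟨y, x, h.symm, rfl, rfl⟩⟩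

lemma nonempty_iso_copyOf (J : SimpleGraph W) (φ : W ↪ Fin n) :
    Nonempty (J ≃g (copyOf J φ).coe) :=
  ⟨{ toEquiv := Equiv.ofInjective φ φ.injective
     map_rel_iff' := by
      intro a b
      simp only [SimpleGraph.Subgraph.coe_adj, copyOf]
      constructor
      · rintro ⟨x, y, h, hx, hy⟩
        rwa [← φ.injective hx, ← φ.injective hy]
      · exact fun h => ⟨a, b, h, rfl, rfl⟩ }⟩

lemma exists_eq_copyOf {J : SimpleGraph W} {T : (⊤ : SimpleGraph (Fin n)).Subgraph}
    (h : Nonempty (J ≃g T.coe)) : ∃ φ : W ↪ Fin n, copyOf J φ = T := by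
  obtain ⟨f⟩ := h
  refine ⟨f.toEquiv.toEmbedding.trans (Function.Embedding.subtype _), ?_⟩
  ext a b
  · simp only [copyOf, Set.mem_range]
    constructor
    · rintro ⟨x, rfl⟩; exact (f x).2
    · intro ha; exact ⟨f.symm ⟨a, ha⟩, by simp⟩
  · simp only [copyOf]
    constructor
    · rintro ⟨x, y, hxy, rfl, rfl⟩
      exact f.map_rel_iff.2 hxy
    · intro hab
      refine ⟨f.symm ⟨a, T.edge_vert hab⟩, f.symm ⟨b, T.edge_vert hab.symm⟩, ?_, by simp, by simp⟩
      rw [← f.map_adj_iff]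
      simpa using hab

/-- The copies of `J` in `K_n`. -/
abbrev CopyOf (n : ℕ) (J : SimpleGraph W) :=
  {T : (⊤ : SimpleGraph (Fin n)).Subgraph // Nonempty (J ≃g T.coe)}

noncomputable instance (J : SimpleGraph W) : Fintype (CopyOf n J) := Fintype.ofFinite _

lemma copyCount_eq (J : SimpleGraph W) :
    (⊤ : SimpleGraph (Fin n)).copyCount J = Fintype.card (CopyOf n J) := by
  classical
  rw [SimpleGraph.copyCount, Fintype.card_subtype]
  congr!

lemma edges_copyOf (J : SimpleGraph W) (φ : W ↪ Fin n) :
    (edges (copyOf J φ) : Set (Sym2 (Fin n))) = Sym2.map φ '' J.edgeSet := by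
  ext x
  induction x using Sym2.ind with
  | _ a b =>
    simp only [Finset.mem_coe, mem_edges, SimpleGraph.Subgraph.mem_edgeSet, copyOf, Set.mem_image]
    constructor
    · rintro ⟨x, y, h, rfl, rfl⟩
      exact ⟨s(x, y), h, rfl⟩
    · rintro ⟨z, hz, hzab⟩
      induction z using Sym2.ind with
      | _ x y =>
        rw [Sym2.map_mk, Sym2.eq_iff] at hzab
        rcases hzab with ⟨rfl, rfl⟩ | ⟨rfl, rfl⟩
        · exact ⟨x, y, hz, rfl, rfl⟩
        · exact ⟨y, x, SimpleGraph.Adj.symm hz, rfl, rfl⟩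

lemma card_edges_copyOf (J : SimpleGraph W) (φ : W ↪ Fin n) :
    (edges (copyOf J φ)).card = edgeCount J := by
  rw [← Set.ncard_coe_finset, edges_copyOf,
    Set.ncard_image_of_injective _ (Sym2.map.injective φ.injective), edgeCount]

variable [Fintype W]

lemma copyCount_le_pow (J : SimpleGraph W) :
    (⊤ : SimpleGraph (Fin n)).copyCount J ≤ n ^ Fintype.card W := by
  classical
  rw [copyCount_eq]
  choose f hf using fun T : CopyOf n J => exists_eq_copyOf T.2
  have hinj : Function.Injective fun T => (f T : W → Fin n) := fun S T h => by
    have : f S = f T := DFunLike.coe_injective h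
    exact Subtype.ext (by rw [← hf S, ← hf T, this])
  simpa using Fintype.card_le_of_injective _ hinj

/-- One copy is placed on each vertex set of the right size; these copies are distinct, so there are
at least `n.choose (Fintype.card W)`. -/
lemma pow_le_copyCount_mul (J : SimpleGraph W) (hW : Fintype.card W ≤ n) :
    n ^ Fintype.card W ≤ (⊤ : SimpleGraph (Fin n)).copyCount J *
      Fintype.card W ^ Fintype.card W := by
  classical
  refine (pow_le_choose_mul_pow hW).trans (Nat.mul_le_mul_right _ ?_)
  rw [copyCount_eq]
  set F := {A : Finset (Fin n) // A ∈ Finset.powersetCard (Fintype.card W) Finset.univ}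
  have hF : Fintype.card F = n.choose (Fintype.card W) := by simp [F]
  rw [← hF]
  have hφ : ∀ A : F, ∃ φ : W ↪ Fin n, Set.range φ = (A.1 : Set (Fin n)) := fun A => by
    have hA := (Finset.mem_powersetCard.1 A.2).2
    have g : W ≃ A.1 := Fintype.equivOfCardEq (by simp [hA])
    refine ⟨g.toEmbedding.trans (Function.Embedding.subtype _), ?_⟩
    ext a
    constructor
    · rintro ⟨x, rfl⟩; exact (g x).2
    · intro ha; exact ⟨g.symm ⟨a, ha⟩, by simp⟩
  choose φ hφ using hφ
  refine Fintype.card_le_of_injective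
    (fun A => (⟨copyOf J (φ A), nonempty_iso_copyOf J (φ A)⟩ : CopyOf n J)) fun A B h => ?_
  have h1 : Set.range (φ A) = Set.range (φ B) :=
    congrArg (fun T : CopyOf n J => T.1.verts) h
  rw [hφ, hφ] at h1
  exact Subtype.ext (by exact_mod_cast h1)

/-- The functions into `Fin n`, weighted by `1 / n` for each value outside of `A`. -/
lemma sum_pow_card_notMem_le [DecidableEq W] (hn : 0 < n) (A : Finset (Fin n)) :
    ∑ φ : W → Fin n, ((n : ℝ)⁻¹) ^ (Finset.univ.filter fun x => φ x ∉ A).card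
      ≤ ((A.card : ℝ) + 1) ^ Fintype.card W := by
  classical
  have h1 : ∀ φ : W → Fin n, ((n : ℝ)⁻¹) ^ (Finset.univ.filter fun x => φ x ∉ A).card
      = ∏ x, (if φ x ∉ A then (n : ℝ)⁻¹ else 1) := fun φ => by
    rw [Finset.prod_ite]; simp
  simp only [h1]
  -- The sum factorises over `W`; each factor is `|A| + (n - |A|) / n ≤ |A| + 1`.
  have h2 := Finset.prod_univ_sum (fun _ : W => (Finset.univ : Finset (Fin n)))
    (fun _ a => if a ∉ A then (n : ℝ)⁻¹ else 1)
  rw [Fintype.piFinset_univ] at h2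
  rw [← h2, Finset.prod_const, Finset.card_univ]
  refine pow_le_pow_left₀ (Finset.sum_nonneg fun a _ => by positivity) ?_ _
  have h3 : ∀ a ∈ (Finset.univ : Finset (Fin n)), (if a ∉ A then (n : ℝ)⁻¹ else 1)
      ≤ (if a ∈ A then 1 else 0) + (n : ℝ)⁻¹ := fun a _ => by
    have : (0 : ℝ) ≤ (n : ℝ)⁻¹ := by positivity
    by_cases ha : a ∈ A <;> simp [ha]
  refine (Finset.sum_le_sum h3).trans ?_
  rw [Finset.sum_add_distrib]
  have : (n : ℝ) ≠ 0 := by exact_mod_cast hn.ne'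
  simp [this]

variable {k : ℕ} {H : SimpleGraph (Fin k)}

/-- The part of `H` that is mapped into `T` by an injection of the vertices. -/
def overlap (H : SimpleGraph (Fin k)) (σ : Fin k ↪ Fin n)
    (T : (⊤ : SimpleGraph (Fin n)).Subgraph) : H.Subgraph where
  verts := {a | σ a ∈ T.verts}
  Adj a b := H.Adj a b ∧ T.Adj (σ a) (σ b)
  adj_sub h := h.1
  edge_vert h := T.edge_vert h.2
  symm := ⟨fun _ _ h => ⟨h.1.symm, h.2.symm⟩⟩

lemma edgeCount_coe {V : Type*} {H : SimpleGraph V} (I : H.Subgraph) :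
    edgeCount I.coe = I.edgeSet.ncard := by
  rw [← SimpleGraph.Subgraph.image_coe_edgeSet_coe,
    Set.ncard_image_of_injective _ (Sym2.map.injective Subtype.val_injective), edgeCount]

lemma edgeCount_overlap (σ : Fin k ↪ Fin n) (T : (⊤ : SimpleGraph (Fin n)).Subgraph) :
    edgeCount (overlap H σ T).coe = (edges T ∩ edges (copyOf H σ)).card := by
  rw [edgeCount_coe, ← Set.ncard_coe_finset, Finset.coe_inter, edges_copyOf,
    ← Set.ncard_image_of_injective _ (Sym2.map.injective σ.injective)]
  congr 1
  ext z
  simp only [Set.mem_image, Set.mem_inter_iff, Finset.mem_coe, mem_edges]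
  constructor
  · rintro ⟨y, hy, rfl⟩
    induction y using Sym2.ind with
    | _ a b => exact ⟨hy.2, s(a, b), hy.1, rfl⟩
  · rintro ⟨hT, y, hy, rfl⟩
    induction y using Sym2.ind with
    | _ a b => exact ⟨s(a, b), ⟨hy, hT⟩, rfl⟩

/-- Summation over the copies of `J` in `K_n`, according to the vertices shared with a fixed copy
of `H`. -/
lemma sum_copyOf_le (hn : 0 < n) (J : SimpleGraph W) (σ : Fin k ↪ Fin n) {K : ℝ} (hK : 0 ≤ K)
    (g : (⊤ : SimpleGraph (Fin n)).Subgraph → ℝ)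
    (hg : ∀ T, Nonempty (J ≃g T.coe) →
      g T * (n : ℝ) ^ Fintype.card W ≤ K * (n : ℝ) ^ (overlap H σ T).verts.ncard) :
    ∑ T : CopyOf n J, g T.1 ≤ K * ((k : ℝ) + 1) ^ Fintype.card W := by
  classical
  have hn' : (0 : ℝ) < n := by exact_mod_cast hn
  set A : Finset (Fin n) := Finset.univ.map σ
  choose f hf using fun T : CopyOf n J => exists_eq_copyOf T.2
  have hinj : Function.Injective fun T => (f T : W → Fin n) := fun S T h => by
    have : f S = f T := DFunLike.coe_injective h
    exact Subtype.ext (by rw [← hf S, ← hf T, this])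
  set w : (W → Fin n) → ℝ := fun φ =>
    ((n : ℝ)⁻¹) ^ (Finset.univ.filter fun x => φ x ∉ A).card with hw
  have h1 : ∀ T : CopyOf n J, g T.1 ≤ K * w (f T) := fun T => by
    -- `overlap` keeps all shared vertices, isolated ones included, so its vertices correspond
    -- exactly to those that `f T` sends into `A`.
    have h2 : (overlap H σ T.1).verts.ncard + (Finset.univ.filter fun x => f T x ∉ A).card
        = Fintype.card W := by
      have h3 : (overlap H σ T.1).verts.ncard = (Finset.univ.filter fun x => f T x ∈ A).card := by
        rw [← Set.ncard_image_of_injective _ σ.injective,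
          ← Finset.card_image_of_injective _ (f T).injective, ← Set.ncard_coe_finset]
        congr 1
        ext a
        have hv : ∀ b, b ∈ T.1.verts ↔ ∃ x, f T x = b := fun b => by
          conv_lhs => rw [← hf T]
          rfl
        simp only [overlap, hv, Set.mem_image, Set.mem_ofPred_eq, A, Finset.coe_image,
          Finset.coe_filter, Finset.mem_map, Finset.mem_univ, true_and]
        constructor
        · rintro ⟨i, ⟨x, hx⟩, rfl⟩
          exact ⟨x, ⟨i, hx.symm⟩, hx⟩
        · rintro ⟨x, ⟨i, hi⟩, rfl⟩
          exact ⟨i, ⟨x, hi.symm⟩, hi⟩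
      rw [h3, Finset.card_filter_add_card_filter_not, Finset.card_univ]
    have h4 := hg T.1 T.2
    rw [← h2, pow_add] at h4
    have h5 : (0 : ℝ) < (n : ℝ) ^ (overlap H σ T.1).verts.ncard := by positivity
    have h6 : (0 : ℝ) < (n : ℝ) ^ (Finset.univ.filter fun x => f T x ∉ A).card := by positivity
    rw [hw]
    simp only [inv_pow]
    rw [← div_eq_mul_inv, le_div_iff₀ h6]
    refine le_of_mul_le_mul_right ?_ h5
    linarith
  calc ∑ T : CopyOf n J, g T.1 ≤ ∑ T : CopyOf n J, K * w (f T) :=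
        Finset.sum_le_sum fun T _ => h1 T
    _ = ∑ φ ∈ Finset.univ.image (fun T => (f T : W → Fin n)), K * w φ := by
        rw [Finset.sum_image hinj.injOn]
    _ ≤ ∑ φ : W → Fin n, K * w φ :=
        Finset.sum_le_sum_of_subset_of_nonneg (Finset.subset_univ _) fun φ _ _ => by positivity
    _ ≤ K * ((k : ℝ) + 1) ^ Fintype.card W := by
        rw [← Finset.mul_sum]
        refine mul_le_mul_of_nonneg_left ?_ hK
        have hA : (A.card : ℝ) = k := by simp [A]
        rw [← hA]
        exact sum_pow_card_notMem_le (W := W) hn A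

end Counting

/-! ### Recovery and impossibility criteria in terms of overlap graphs. -/

section Bounds

variable {n k : ℕ} {H : SimpleGraph (Fin k)} (p : unitInterval)

lemma copies_nonempty (hk : k ≤ n) : (copies n H).Nonempty :=
  ⟨copyOf H (Fin.castLEEmb hk), nonempty_iso_copyOf _ _⟩

/-- Recovery: if few copies of `J ⊆ H` with small overlap with the planted copy of `H` appear. -/
lemma mmse_le (hn : 0 < n) (hk : k ≤ n) (J : H.Subgraph) {t K : ℝ} (ht : 0 ≤ t) (hK : 0 ≤ K)
    (hI : ∀ I : H.Subgraph, (edgeCount I.coe : ℝ) < t → edgeCount I.coe ≤ edgeCount J.coe →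
      (p : ℝ) ^ (edgeCount J.coe - edgeCount I.coe) * (n : ℝ) ^ J.verts.ncard
        ≤ K * (n : ℝ) ^ I.verts.ncard) :
    mmse n H p ≤ edgeCount H - t * (1 - K * ((k : ℝ) + 1) ^ k) := by
  classical
  have hne := copies_nonempty (H := H) hk
  have := hne.to_subtype
  rw [mmse_eq_finiteMMSE p hne]
  have hW : Fintype.card J.verts = J.verts.ncard := by
    rw [← Nat.card_eq_fintype_card, Nat.card_coe_set_eq]
  have hJk : J.verts.ncard ≤ k := by
    simpa using Set.ncard_le_ncard (Set.subset_univ J.verts)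
  have hsub : ∀ S : copies n H, edges S.1 ⊆ allEdges n := fun S => edges_subset S.1
  have hcard : ∀ S : copies n H, (edges S.1).card = edgeCount H :=
    fun S => edgeSet_ncard_of_mem_copies S.2
  -- The test sets are the copies of `J`; restricting the embedding of a copy of `H` to `J` shows
  -- that it contains one.
  refine finiteMMSE_le (ed := fun S : copies n H => edges S.1) hsub hcard
    p.2.1 p.2.2 (κ := CopyOf n J.coe) (fun T => edges T.1) (fun T => edges_subset T.1) ht ?_ ?_
  · intro S
    obtain ⟨σ, hσ⟩ := exists_eq_copyOf S.2
    refine ⟨⟨copyOf J.coe ((Function.Embedding.subtype _).trans σ), nonempty_iso_copyOf _ _⟩, ?_⟩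
    rw [← hσ]
    intro x
    rw [← Finset.mem_coe, ← Finset.mem_coe, edges_copyOf, edges_copyOf]
    rintro ⟨z, hz, rfl⟩
    induction z using Sym2.ind with
    | _ a b => exact ⟨s(a.1, b.1), J.adj_sub hz, rfl⟩
  · intro S
    obtain ⟨σ, hσ⟩ := exists_eq_copyOf S.2
    rw [Finset.sum_filter]
    refine (sum_copyOf_le hn J.coe σ (H := H) hK (fun T => if ((edges T ∩ edges S.1).card : ℝ) < t
      then (p : ℝ) ^ (edges T \ edges S.1).card else 0) ?_).trans ?_
    · intro T hT
      split_ifs with h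
      · obtain ⟨φ, hφ⟩ := exists_eq_copyOf hT
        rw [← hσ, ← edgeCount_overlap] at h
        have hle : edgeCount (overlap H σ T).coe ≤ edgeCount J.coe := by
          rw [edgeCount_overlap, ← card_edges_copyOf J.coe φ, hφ]
          exact Finset.card_le_card Finset.inter_subset_left
        rw [hW]
        convert hI _ h hle using 3
        rw [edgeCount_overlap, ← card_edges_copyOf J.coe φ, hφ, ← hσ]
        have := Finset.card_sdiff_add_card_inter (edges T) (edges (copyOf H σ))
        omega
      · rw [zero_mul]; positivity
    · rw [hW]
      refine mul_le_mul_of_nonneg_left (pow_le_pow_right₀ ?_ hJk) hK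
      have : (0 : ℝ) ≤ k := by positivity
      linarith

/-- Impossibility: if pairs of copies with large overlap are rare. -/
lemma le_mmse (hn : 0 < n) (hk : k ≤ n) (hp : 0 < (p : ℝ)) {t K : ℝ} (ht : 0 ≤ t) (hK : 0 < K)
    (hI : ∀ I : H.Subgraph, t ≤ (edgeCount I.coe : ℝ) →
      ((p : ℝ)⁻¹) ^ edgeCount I.coe ≤ K * (n : ℝ) ^ I.verts.ncard) :
    edgeCount H - t - 2 * edgeCount H * √(K * ((k : ℝ) * (k + 1)) ^ k) ≤ mmse n H p := by
  classical
  have hne := copies_nonempty (H := H) hk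
  have := hne.to_subtype
  have hkk : (0 : ℝ) < ((k : ℝ) * (k + 1)) ^ k := by
    rcases k.eq_zero_or_pos with rfl | h
    · simp
    · positivity
  rw [mmse_eq_finiteMMSE p hne]
  have hsub : ∀ S : copies n H, edges S.1 ⊆ allEdges n := fun S => edges_subset S.1
  have hcard : ∀ S : copies n H, (edges S.1).card = edgeCount H :=
    fun S => edgeSet_ncard_of_mem_copies S.2
  refine le_finiteMMSE (ed := fun S : copies n H => edges S.1) hsub hcard
    hp p.2.2 ht (Real.sqrt_pos.2 (by positivity)) fun S => ?_
  obtain ⟨σ, hσ⟩ := exists_eq_copyOf S.2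
  rw [Real.sq_sqrt (by positivity), Finset.sum_filter]
  have hn' : (0 : ℝ) < n := by exact_mod_cast hn
  have h1 := sum_copyOf_le hn H σ (H := H) (K := K * (n : ℝ) ^ k) (by positivity)
    (fun T => if t ≤ ((edges S.1 ∩ edges T).card : ℝ)
      then ((p : ℝ)⁻¹) ^ (edges S.1 ∩ edges T).card else 0) (fun T hT => by
      rw [Finset.inter_comm, ← hσ, ← edgeCount_overlap, Fintype.card_fin]
      split_ifs with h
      · have := mul_le_mul_of_nonneg_right (hI _ h) (by positivity : (0 : ℝ) ≤ (n : ℝ) ^ k)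
        linarith
      · rw [zero_mul]; positivity)
  -- Replacing `n ^ k` by the number of copies costs the factor `k ^ k` under the root; `(k + 1) ^
  -- k` comes from `sum_copyOf_le`.
  have h2 : (n : ℝ) ^ k ≤ Fintype.card (copies n H) * (k : ℝ) ^ k := by
    have := pow_le_copyCount_mul H (n := n) (by simpa using hk)
    rw [Fintype.card_fin, copyCount_eq] at this
    have h3 : Fintype.card (CopyOf n H) = Fintype.card (copies n H) := Fintype.card_congr (Equiv.refl _)
    rw [h3] at this
    exact_mod_cast this
  rw [Fintype.card_fin] at h1
  have h4 : ∑ S' : copies n H, (if t ≤ ((edges S.1 ∩ edges S'.1).card : ℝ)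
      then ((p : ℝ)⁻¹) ^ (edges S.1 ∩ edges S'.1).card else 0) ≤ K * (n : ℝ) ^ k * ((k : ℝ) + 1) ^ k := by
    exact le_of_eq_of_le (Fintype.sum_equiv (Equiv.refl _) _ _ fun _ => rfl) h1
  refine h4.trans ?_
  calc K * (n : ℝ) ^ k * ((k : ℝ) + 1) ^ k
      ≤ K * (Fintype.card (copies n H) * (k : ℝ) ^ k) * ((k : ℝ) + 1) ^ k := by gcongr
    _ = _ := by rw [mul_pow]; ring

end Bounds

/-! ### First moments of subgraphs at `ψ_q`. -/

section Thresholds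

variable {n k : ℕ} {H : SimpleGraph (Fin k)}

lemma verts_ncard_le (J : H.Subgraph) : J.verts.ncard ≤ k := by
  simpa using Set.ncard_le_ncard (Set.subset_univ J.verts)

lemma edgeCount_coe_le (J : H.Subgraph) : edgeCount J.coe ≤ edgeCount H := by
  rw [edgeCount_coe]
  exact Set.ncard_le_ncard J.edgeSet_subset (Set.toFinite _)

lemma copyCount_coe_le (J : H.Subgraph) :
    (⊤ : SimpleGraph (Fin n)).copyCount J.coe ≤ n ^ J.verts.ncard := by
  classical
  have := copyCount_le_pow (n := n) J.coe
  rwa [← Nat.card_eq_fintype_card, Nat.card_coe_set_eq] at this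

lemma pow_le_copyCount_coe_mul (hk : k ≤ n) (J : H.Subgraph) :
    n ^ J.verts.ncard ≤ (⊤ : SimpleGraph (Fin n)).copyCount J.coe *
      J.verts.ncard ^ J.verts.ncard := by
  classical
  have := pow_le_copyCount_mul (n := n) J.coe
  rw [← Nat.card_eq_fintype_card, Nat.card_coe_set_eq] at this
  exact this ((verts_ncard_le J).trans hk)

lemma copyCount_coe_pos (hn : 0 < n) (hk : k ≤ n) (J : H.Subgraph) :
    0 < (⊤ : SimpleGraph (Fin n)).copyCount J.coe := by
  have h1 := pow_le_copyCount_coe_mul hk J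
  have h2 : 0 < n ^ J.verts.ncard := by positivity
  exact Nat.pos_of_ne_zero fun h => by rw [h] at h1; omega

lemma firstMomentThreshold_pow_mul (hn : 0 < n) (hk : k ≤ n) (J : H.Subgraph)
    (hJ : edgeCount J.coe ≠ 0) :
    firstMomentThreshold n J.coe ^ edgeCount J.coe *
      (⊤ : SimpleGraph (Fin n)).copyCount J.coe = 1 := by
  have h : (0 : ℝ) < (⊤ : SimpleGraph (Fin n)).copyCount J.coe := by
    exact_mod_cast copyCount_coe_pos hn hk J
  have hJ' : (edgeCount J.coe : ℝ) ≠ 0 := by exact_mod_cast hJ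
  rw [firstMomentThreshold, ← Real.rpow_natCast, ← Real.rpow_mul h.le, div_mul_cancel₀ _ hJ',
    Real.rpow_neg_one, inv_mul_cancel₀ h.ne']

lemma firstMomentThreshold_pos (hn : 0 < n) (hk : k ≤ n) (J : H.Subgraph) :
    0 < firstMomentThreshold n J.coe :=
  Real.rpow_pos_of_pos (by exact_mod_cast copyCount_coe_pos hn hk J) _

lemma firstMomentThreshold_le_one (hn : 0 < n) (hk : k ≤ n) (J : H.Subgraph) :
    firstMomentThreshold n J.coe ≤ 1 := by
  refine Real.rpow_le_one_of_one_le_of_nonpos (by exact_mod_cast copyCount_coe_pos hn hk J) ?_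
  exact div_nonpos_of_nonpos_of_nonneg (by norm_num) (by positivity)

lemma isLarge_top {q : ℝ} (hq : q ≤ 1) (he : 0 < edgeCount H) :
    IsLarge q (⊤ : H.Subgraph) := by
  have h : edgeCount (⊤ : H.Subgraph).coe = edgeCount H := by
    rw [edgeCount_coe, SimpleGraph.Subgraph.edgeSet_top, edgeCount]
  rw [IsLarge, h]
  refine max_le (by exact_mod_cast he) (mul_le_of_le_one_left (by positivity) hq)

lemma IsLarge.mono {q q' : ℝ} (h : q' ≤ q) {J : H.Subgraph} (hJ : IsLarge q J) :
    IsLarge q' J :=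
  le_trans (max_le_max le_rfl (mul_le_mul_of_nonneg_right h (by positivity))) hJ

lemma IsLarge.edgeCount_ne_zero {q : ℝ} {J : H.Subgraph} (hJ : IsLarge q J) :
    edgeCount J.coe ≠ 0 := by
  have : (1 : ℝ) ≤ edgeCount J.coe := (le_max_left _ _).trans hJ
  intro h
  rw [h] at this
  norm_num at this

lemma finite_psi_set (q : ℝ) (f : H.Subgraph → ℝ) :
    {x : ℝ | ∃ J : H.Subgraph, IsLarge q J ∧ x = f J}.Finite :=
  (Set.finite_range f).subset (by rintro x ⟨J, -, rfl⟩; exact ⟨J, rfl⟩)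

lemma firstMomentThreshold_le_psi {q : ℝ} {J : H.Subgraph} (hJ : IsLarge q J) :
    firstMomentThreshold n J.coe ≤ psi n q H :=
  le_csSup (finite_psi_set q _).bddAbove ⟨J, hJ, rfl⟩

lemma exists_psi_eq (n : ℕ) {q : ℝ} (hq : q ≤ 1) (he : 0 < edgeCount H) :
    ∃ J : H.Subgraph, IsLarge q J ∧ psi n q H = firstMomentThreshold n J.coe :=
  Set.Nonempty.csSup_mem (s := {x : ℝ | ∃ J : H.Subgraph, IsLarge q J ∧
    x = firstMomentThreshold n J.coe}) ⟨_, ⊤, isLarge_top hq he, rfl⟩ (finite_psi_set q _)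

lemma exists_alpha_eq {q : ℝ} (hq : q ≤ 1) (he : 0 < edgeCount H) :
    ∃ J : H.Subgraph, IsLarge q J ∧ alpha q H = (J.verts.ncard : ℝ) / (edgeCount J.coe : ℝ) :=
  Set.Nonempty.csInf_mem (s := {x : ℝ | ∃ J : H.Subgraph, IsLarge q J ∧
    x = (J.verts.ncard : ℝ) / (edgeCount J.coe : ℝ)}) ⟨_, ⊤, isLarge_top hq he, rfl⟩
    (finite_psi_set q _)

lemma alpha_le {q : ℝ} {J : H.Subgraph} (hJ : IsLarge q J) :
    alpha q H ≤ (J.verts.ncard : ℝ) / (edgeCount J.coe : ℝ) :=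
  csInf_le (finite_psi_set q _).bddBelow ⟨J, hJ, rfl⟩

lemma alpha_mono {q q' : ℝ} (h : q' ≤ q) (hq : q ≤ 1) (he : 0 < edgeCount H) :
    alpha q' H ≤ alpha q H := by
  obtain ⟨J, hJ, h1⟩ := exists_alpha_eq hq he
  exact h1 ▸ alpha_le (hJ.mono h)

lemma psi_anti {q q' : ℝ} (h : q' ≤ q) (hq : q ≤ 1) (he : 0 < edgeCount H) :
    psi n q H ≤ psi n q' H := by
  obtain ⟨J, hJ, h1⟩ := exists_psi_eq n hq he
  exact h1 ▸ firstMomentThreshold_le_psi (hJ.mono h)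

lemma psi_pos {q : ℝ} (hn : 0 < n) (hk : k ≤ n) (hq : q ≤ 1) (he : 0 < edgeCount H) :
    0 < psi n q H := by
  obtain ⟨J, hJ, h1⟩ := exists_psi_eq n hq he
  exact h1 ▸ firstMomentThreshold_pos hn hk J

lemma psi_le_one {q : ℝ} (hn : 0 < n) (hk : k ≤ n) (hq : q ≤ 1) (he : 0 < edgeCount H) :
    psi n q H ≤ 1 := by
  obtain ⟨J, hJ, h1⟩ := exists_psi_eq n hq he
  exact h1 ▸ firstMomentThreshold_le_one hn hk J

/-- At its own threshold `I` has first moment exactly `1`; passing to `ψ_q` and to `n ^ v(I)` only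
increases it. -/
lemma one_le_psi_pow_mul {q : ℝ} (hn : 0 < n) (hk : k ≤ n) {I : H.Subgraph} (hI : IsLarge q I) :
    1 ≤ psi n q H ^ edgeCount I.coe * (n : ℝ) ^ I.verts.ncard := by
  rw [← firstMomentThreshold_pow_mul hn hk I hI.edgeCount_ne_zero]
  have h1 := firstMomentThreshold_pos hn hk I
  have h2 := firstMomentThreshold_le_psi (n := n) hI
  have h3 : ((⊤ : SimpleGraph (Fin n)).copyCount I.coe : ℝ) ≤ (n : ℝ) ^ I.verts.ncard := by
    exact_mod_cast copyCount_coe_le I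
  have h4 := h1.trans_le h2
  gcongr

/-- The maximiser `J` has first moment exactly `1` at `ψ_q`; the factor `k ^ k` pays for replacing
its number of copies by `n ^ v(J)`. -/
lemma exists_psi_pow_mul_le {q : ℝ} (hn : 0 < n) (hk : k ≤ n) (hq : q ≤ 1)
    (he : 0 < edgeCount H) :
    ∃ J : H.Subgraph, IsLarge q J ∧
      psi n q H ^ edgeCount J.coe * (n : ℝ) ^ J.verts.ncard ≤ (k : ℝ) ^ k := by
  obtain ⟨J, hJ, h1⟩ := exists_psi_eq n hq he
  refine ⟨J, hJ, ?_⟩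
  have h2 := firstMomentThreshold_pow_mul hn hk J hJ.edgeCount_ne_zero
  have h3 : (n : ℝ) ^ J.verts.ncard ≤ (⊤ : SimpleGraph (Fin n)).copyCount J.coe * (k : ℝ) ^ k := by
    have h4 := pow_le_copyCount_coe_mul hk J
    have h5 : J.verts.ncard ^ J.verts.ncard ≤ k ^ k := by
      rcases J.verts.ncard.eq_zero_or_pos with h0 | h0
      · rw [h0, pow_zero]
        exact Nat.one_le_iff_ne_zero.2 (by rcases k.eq_zero_or_pos with rfl | h <;> positivity)
      · exact (Nat.pow_le_pow_left (verts_ncard_le J) _).trans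
          (Nat.pow_le_pow_right (h0.trans_le (verts_ncard_le J)) (verts_ncard_le J))
    exact_mod_cast h4.trans (Nat.mul_le_mul_left _ h5)
  have h6 := firstMomentThreshold_pos hn hk J
  rw [h1]
  calc _ ≤ firstMomentThreshold n J.coe ^ edgeCount J.coe *
        ((⊤ : SimpleGraph (Fin n)).copyCount J.coe * (k : ℝ) ^ k) := by gcongr
    _ = _ := by rw [← mul_assoc, h2, one_mul]

/-- Delocalization bounds the first moment of the small subgraphs of `H` as well. -/
lemma one_le_exp_mul_psi_pow_mul {q C : ℝ} (hn : 2 ≤ n) (hk : k ≤ n) (hq : q ≤ 1)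
    (he : 0 < edgeCount H) (hα : alpha q H ≤ alpha 0 H + C / Real.log n) (I : H.Subgraph) :
    1 ≤ Real.exp (C * edgeCount I.coe) *
      (psi n q H ^ edgeCount I.coe * (n : ℝ) ^ I.verts.ncard) := by
  have hn0 : 0 < n := by omega
  have hn' : (1 : ℝ) < n := by exact_mod_cast hn
  have hL : 0 < Real.log n := Real.log_pos hn'
  have hψ := psi_pos hn0 hk hq he
  rcases Nat.eq_zero_or_pos (edgeCount I.coe) with h0 | h0
  · rw [h0]
    simpa using one_le_pow₀ (n := I.verts.ncard) hn'.le
  have h0' : (0 : ℝ) < edgeCount I.coe := by exact_mod_cast h0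
  obtain ⟨J, hJ, h1⟩ := exists_alpha_eq hq he
  have hJ0 : (0 : ℝ) < edgeCount J.coe := by
    exact_mod_cast Nat.pos_of_ne_zero hJ.edgeCount_ne_zero
  have h2 := Real.log_nonneg (one_le_psi_pow_mul hn0 hk hJ)
  rw [Real.log_mul (by positivity) (by positivity), Real.log_pow, Real.log_pow] at h2
  have hI : IsLarge 0 I := by
    rw [IsLarge, zero_mul, max_eq_left zero_le_one]; exact_mod_cast h0
  have h3 := alpha_le hI
  -- This is the first moment bound, per edge, of the large subgraph attaining `alpha q H`.
  -- Delocalization passes it to `alpha 0 H`, hence to every `I`; the error `C / log n` becomes the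
  -- constant `C` per edge.
  have h4 : 0 ≤ Real.log (psi n q H) + alpha q H * Real.log n := by
    rw [h1]
    have : 0 ≤ (edgeCount J.coe * Real.log (psi n q H) + J.verts.ncard * Real.log n) /
        edgeCount J.coe := by positivity
    refine this.trans_eq ?_
    field_simp
  have h5 : alpha q H * Real.log n ≤ alpha 0 H * Real.log n + C := by
    have := mul_le_mul_of_nonneg_right hα hL.le
    rwa [add_mul, div_mul_cancel₀ _ hL.ne'] at this
  have h6 : alpha 0 H * Real.log n ≤ I.verts.ncard / edgeCount I.coe * Real.log n :=
    mul_le_mul_of_nonneg_right h3 hL.le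
  have h7 : 0 ≤ edgeCount I.coe * (Real.log (psi n q H) +
      I.verts.ncard / edgeCount I.coe * Real.log n + C) :=
    mul_nonneg h0'.le (by linarith)
  have h8 : 0 ≤ C * edgeCount I.coe + (edgeCount I.coe * Real.log (psi n q H) +
      I.verts.ncard * Real.log n) := by
    refine h7.trans_eq ?_
    field_simp
    ring
  rw [← Real.log_nonneg_iff (by positivity), Real.log_mul (by positivity) (by positivity),
    Real.log_exp, Real.log_mul (by positivity) (by positivity), Real.log_pow, Real.log_pow]
  exact h8

end Thresholds

/-! ### MMSE bounds above and below `ψ_q` for fixed `n`. -/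

section Mmse

variable {n k : ℕ} {H : SimpleGraph (Fin k)} (p : unitInterval)

lemma mmse_nonneg : 0 ≤ mmse n H p :=
  integral_nonneg fun _ => Finset.sum_nonneg fun _ _ => sq_nonneg _

lemma mmse_le_edgeCount (hn : 0 < n) (hk : k ≤ n) : mmse n H p ≤ edgeCount H := by
  simpa using mmse_le p hn hk (⊤ : H.Subgraph) le_rfl le_rfl fun I h => absurd h (by simp)

/-- Above the threshold `ψ_q`, at most about a fraction `q` of the edges can be recovered. -/
lemma le_mmse_of_psi_lt {q a : ℝ} (hn : 0 < n) (hk : k ≤ n) (hq : q ≤ 1)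
    (he : 0 < edgeCount H) (hqe : 1 ≤ q * edgeCount H) (ha : 0 < a)
    (hp : Real.exp a * psi n q H ≤ p) :
    edgeCount H - q * edgeCount H - 2 * edgeCount H *
      √(Real.exp (-(a * (q * edgeCount H))) * ((k : ℝ) * (k + 1)) ^ k) ≤ mmse n H p := by
  have hψ := psi_pos hn hk hq he
  have hp0 : 0 < (p : ℝ) := lt_of_lt_of_le (by positivity) hp
  refine le_mmse p hn hk hp0 (by positivity) (Real.exp_pos _) fun I hI => ?_
  have h1 := one_le_psi_pow_mul hn hk (I := I) (q := q) (max_le (hqe.trans hI) hI)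
  have h2 : (Real.exp a * psi n q H) ^ edgeCount I.coe ≤ (p : ℝ) ^ edgeCount I.coe :=
    pow_le_pow_left₀ (by positivity) hp _
  rw [mul_pow, ← Real.exp_nat_mul] at h2
  rw [inv_pow, inv_le_iff_one_le_mul₀ (by positivity)]
  refine h1.trans ?_
  have h3 : Real.exp (a * (q * edgeCount H)) * psi n q H ^ edgeCount I.coe
      ≤ (p : ℝ) ^ edgeCount I.coe := by
    refine le_trans (mul_le_mul_of_nonneg_right (Real.exp_le_exp.2 ?_) (by positivity)) h2
    rw [mul_comm]
    exact mul_le_mul_of_nonneg_right hI ha.le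
  rw [Real.exp_neg, mul_right_comm]
  refine mul_le_mul_of_nonneg_right ?_ (by positivity)
  rw [le_inv_mul_iff₀ (Real.exp_pos _)]
  exact h3

/-- Below the threshold `ψ_q`, a fraction `τ < q` of the edges can be recovered, if the small
subgraphs of `H` are not much denser. -/
lemma mmse_le_of_lt_psi {q a κ τ : ℝ} (hn : 0 < n) (hk : k ≤ n) (hq : q ≤ 1)
    (he : 0 < edgeCount H) (ha : 0 < a) (hτ : 0 ≤ τ)
    (hp : p ≤ Real.exp (-a) * psi n q H)
    (hI : ∀ I : H.Subgraph, (edgeCount I.coe : ℝ) < τ * edgeCount H →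
      1 ≤ Real.exp (κ * edgeCount H) * (psi n q H ^ edgeCount I.coe * (n : ℝ) ^ I.verts.ncard)) :
    mmse n H p ≤ edgeCount H - τ * edgeCount H *
      (1 - Real.exp ((κ - a * (q - τ)) * edgeCount H) * ((k : ℝ) * (k + 1)) ^ k) := by
  have hψ := psi_pos hn hk hq he
  obtain ⟨J, hJ, h1⟩ := exists_psi_pow_mul_le hn hk hq he
  have hqJ : q * edgeCount H ≤ edgeCount J.coe := (le_max_right _ _).trans hJ
  -- At least `(q - τ) e(H)` edges of `J` are unplanted, and each gains `exp (-a)` from `p < ψ_q`;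
  -- `exp (κ e(H))` and `k ^ k` bound the ratio of the first moments of `J` and `I` at `ψ_q`.
  refine (mmse_le p hn hk J (t := τ * edgeCount H)
    (K := Real.exp ((κ - a * (q - τ)) * edgeCount H) * (k : ℝ) ^ k) (by positivity)
    (by positivity) fun I hIτ hIJ => ?_).trans_eq (by rw [mul_pow]; ring)
  have h2 := hI I hIτ
  set d := edgeCount J.coe - edgeCount I.coe with hd
  have hdJ : d + edgeCount I.coe = edgeCount J.coe := by omega
  have hd' : (d : ℝ) + edgeCount I.coe = edgeCount J.coe := by exact_mod_cast hdJ
  have h3 : (p : ℝ) ^ d ≤ (Real.exp (-a) * psi n q H) ^ d := pow_le_pow_left₀ p.2.1 hp _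
  rw [mul_pow, ← Real.exp_nat_mul] at h3
  have h4 : Real.exp (d * -a) ≤ Real.exp (-(a * (q - τ)) * edgeCount H) := by
    refine Real.exp_le_exp.2 ?_
    nlinarith
  calc (p : ℝ) ^ d * (n : ℝ) ^ J.verts.ncard
      ≤ (Real.exp (-(a * (q - τ)) * edgeCount H) * psi n q H ^ d) * (n : ℝ) ^ J.verts.ncard := by
        refine mul_le_mul_of_nonneg_right (h3.trans ?_) (by positivity)
        exact mul_le_mul_of_nonneg_right h4 (by positivity)
    _ ≤ (Real.exp (-(a * (q - τ)) * edgeCount H) * psi n q H ^ d) * (n : ℝ) ^ J.verts.ncard *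
        (Real.exp (κ * edgeCount H) *
          (psi n q H ^ edgeCount I.coe * (n : ℝ) ^ I.verts.ncard)) :=
        le_mul_of_one_le_right (by positivity) h2
    _ = Real.exp ((κ - a * (q - τ)) * edgeCount H) *
        (psi n q H ^ edgeCount J.coe * (n : ℝ) ^ J.verts.ncard) * (n : ℝ) ^ I.verts.ncard := by
        have : Real.exp ((κ - a * (q - τ)) * edgeCount H) =
            Real.exp (κ * edgeCount H) * Real.exp (-(a * (q - τ)) * edgeCount H) := by
          rw [← Real.exp_add]; ring_nf
        rw [← hdJ, pow_add, this]
        ring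
    _ ≤ _ := by
        gcongr

end Mmse

/-! ### Asymptotics and the all-or-nothing criterion. -/

section Asymptotics

variable {v : ℕ → ℕ} {H : ∀ n, SimpleGraph (Fin (v n))}

lemma IsDense.tendsto_edgeCount (h : IsDense H) :
    Tendsto (fun n => (edgeCount (H n) : ℝ)) atTop atTop := by
  have hv : Tendsto (fun n => (v n : ℝ)) atTop atTop := tendsto_natCast_atTop_atTop.comp h.1
  refine tendsto_atTop_mono' _ ?_ hv
  filter_upwards [h.2.eventually_ge_atTop 1, hv.eventually_ge_atTop 3] with n h1 h2
  have hl : 1 ≤ Real.log (v n) := by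
    rw [Real.le_log_iff_exp_le (by linarith)]
    linarith [Real.exp_one_lt_d9]
  rw [le_div_iff₀ (by positivity), one_mul] at h1
  nlinarith

/-- Density makes the counting factors harmless: they are at most `exp (3 v log v)`, and `v log v =
o(e(H))`. -/
lemma IsDense.eventually_pow_le (h : IsDense H) {η : ℝ} (hη : 0 < η) :
    ∀ᶠ n in atTop, ((v n : ℝ) * (v n + 1)) ^ v n ≤ Real.exp (η * edgeCount (H n)) := by
  have hv : Tendsto (fun n => (v n : ℝ)) atTop atTop := tendsto_natCast_atTop_atTop.comp h.1
  filter_upwards [h.2.eventually_ge_atTop (3 / η), hv.eventually_ge_atTop 3] with n h1 h2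
  have hv0 : (0 : ℝ) < v n := by linarith
  have hl : 0 < Real.log (v n) := Real.log_pos (by linarith)
  rw [le_div_iff₀ (by positivity), div_mul_eq_mul_div, div_le_iff₀ hη] at h1
  have h3 : (v n : ℝ) * (v n + 1) ≤ (v n : ℝ) ^ 3 := by nlinarith [sq_nonneg ((v n : ℝ) - 3)]
  calc ((v n : ℝ) * (v n + 1)) ^ v n ≤ ((v n : ℝ) ^ 3) ^ v n := by gcongr
    _ = Real.exp (3 * (v n * Real.log (v n))) := by
        rw [← pow_mul, ← Real.exp_log (pow_pos hv0 (3 * v n)), Real.log_pow]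
        push_cast
        ring_nf
    _ ≤ _ := Real.exp_le_exp.2 (by linarith)

lemma IsDense.eventually_pos (h : IsDense H) :
    ∀ᶠ n in atTop, 2 ≤ n ∧ 0 < edgeCount (H n) := by
  filter_upwards [eventually_ge_atTop 2, h.tendsto_edgeCount.eventually_gt_atTop 0] with n h1 h2
  exact ⟨h1, by exact_mod_cast h2⟩

lemma IsDense.eventually_exp_mul_pow_le (h : IsDense H) {c δ : ℝ} (hc : 0 < c) (hδ : 0 < δ) :
    ∀ᶠ n in atTop, Real.exp (-(c * edgeCount (H n))) * ((v n : ℝ) * (v n + 1)) ^ v n ≤ δ := by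
  have h2 : Tendsto (fun n => Real.exp (-(c / 2 * edgeCount (H n)))) atTop (𝓝 0) :=
    Real.tendsto_exp_neg_atTop_nhds_zero.comp
      (h.tendsto_edgeCount.const_mul_atTop (half_pos hc))
  filter_upwards [h.eventually_pow_le (half_pos hc), h2.eventually_le_const hδ] with n h3 h4
  refine (mul_le_mul_of_nonneg_left h3 (Real.exp_pos _).le).trans ?_
  rw [← Real.exp_add]
  refine le_trans (le_of_eq ?_) h4
  ring_nf

/-- Above `ψ_q`, at most about a fraction `q` of the edges can be recovered. -/
lemma IsDense.eventually_le_mmse (hv : ∀ n, v n ≤ n) (h : IsDense H) {q ε δ : ℝ} (hq0 : 0 < q)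
    (hq : q ≤ 1) (hε : 0 < ε) (hδ : 0 < δ) :
    ∀ᶠ n in atTop, ∀ p : unitInterval, (1 + ε) * psi n q (H n) ≤ p →
      1 - q - δ ≤ mmse n (H n) p / edgeCount (H n) := by
  have ha : 0 < Real.log (1 + ε) := Real.log_pos (by linarith)
  filter_upwards [h.eventually_pos, h.tendsto_edgeCount.eventually_ge_atTop (1 / q),
    h.eventually_exp_mul_pow_le (mul_pos ha hq0) (pow_pos (half_pos hδ) 2)]
    with n ⟨hn, he⟩ hqe hexp p hp
  have he' : (0 : ℝ) < edgeCount (H n) := by exact_mod_cast he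
  rw [div_le_iff₀ hq0, mul_comm] at hqe
  rw [← Real.exp_log (by linarith : 0 < 1 + ε)] at hp
  have h1 := le_mmse_of_psi_lt p (by omega) (hv n) hq he hqe ha hp
  have h2 : √(Real.exp (-(Real.log (1 + ε) * (q * edgeCount (H n)))) *
      ((v n : ℝ) * (v n + 1)) ^ v n) ≤ δ / 2 := by
    rw [← mul_assoc]
    exact Real.sqrt_le_iff.2 ⟨by positivity, hexp⟩
  rw [le_div_iff₀ he']
  have := mul_le_mul_of_nonneg_left h2 (by positivity : 0 ≤ 2 * (edgeCount (H n) : ℝ))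
  linarith

/-- Below `ψ_q`, a fraction `τ < q` of the edges can be recovered, if the small
subgraphs of `H` are not much denser. -/
lemma IsDense.eventually_mmse_le (hv : ∀ n, v n ≤ n) (h : IsDense H) {q ρ τ δ : ℝ} (hτ : 0 < τ)
    (hτq : τ < q) (hq : q ≤ 1) (hρ0 : 0 < ρ) (hρ : ρ < 1) (hδ : 0 < δ) :
    ∀ᶠ n in atTop, ∀ p : unitInterval, p ≤ ρ * psi n q (H n) →
      (∀ I : (H n).Subgraph, (edgeCount I.coe : ℝ) < τ * edgeCount (H n) →
        1 ≤ Real.exp (-Real.log ρ * (q - τ) / 2 * edgeCount (H n)) *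
          (psi n q (H n) ^ edgeCount I.coe * (n : ℝ) ^ I.verts.ncard)) →
      mmse n (H n) p / edgeCount (H n) ≤ 1 - τ * (1 - δ) := by
  have ha : 0 < -Real.log ρ := neg_pos.2 (Real.log_neg hρ0 hρ)
  -- Half of the gained exponent pays for the small subgraphs; the other half beats the counting
  -- factors.
  have hc : 0 < -Real.log ρ * (q - τ) / 2 := by
    have : 0 < q - τ := sub_pos.2 hτq
    positivity
  filter_upwards [h.eventually_pos, h.eventually_exp_mul_pow_le hc hδ]
    with n ⟨hn, he⟩ hexp p hp hI
  have he' : (0 : ℝ) < edgeCount (H n) := by exact_mod_cast he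
  have h1 := mmse_le_of_lt_psi p (by omega) (hv n) hq he ha hτ.le
    (by rwa [neg_neg, Real.exp_log hρ0]) hI
  rw [div_le_iff₀ he']
  have h2 : (-Real.log ρ * (q - τ) / 2 - -Real.log ρ * (q - τ)) * edgeCount (H n) =
      -(-Real.log ρ * (q - τ) / 2 * edgeCount (H n)) := by ring
  rw [h2] at h1
  have := mul_le_mul_of_nonneg_left hexp (by positivity : 0 ≤ τ * (edgeCount (H n) : ℝ))
  linarith

/-- For delocalized graphs the first moments of all subgraphs are controlled by `ψ_q`. -/
lemma IsDelocalized.exists_bound (hv : ∀ n, v n ≤ n) (h : IsDense H) (hd : IsDelocalized H) :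
    ∃ q₀ ∈ Set.Ioo (0 : ℝ) 1, ∃ C : ℝ, 0 ≤ C ∧ ∀ᶠ n in atTop, ∀ I : (H n).Subgraph,
      1 ≤ Real.exp (C * edgeCount I.coe) *
        (psi n q₀ (H n) ^ edgeCount I.coe * (n : ℝ) ^ I.verts.ncard) := by
  obtain ⟨q, hq0, hq1, C, hC⟩ := hd
  -- Delocalization survives lowering `q`, as `alpha` is monotone in `q`; the cap `1 / 2` keeps `q₀`
  -- in the open interval where balance applies.
  refine ⟨min q (1 / 2), ⟨by positivity, (min_le_right _ _).trans_lt (by norm_num)⟩,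
    max C 0, le_max_right _ _, ?_⟩
  filter_upwards [hC, h.eventually_pos] with n hα ⟨hn, he⟩ I
  refine one_le_exp_mul_psi_pow_mul hn (hv n) ((min_le_left _ _).trans hq1) he ?_ I
  have hL : 0 < Real.log n := Real.log_pos (by exact_mod_cast hn)
  calc alpha (min q (1 / 2)) (H n) ≤ alpha q (H n) := alpha_mono (min_le_left _ _) hq1 he
    _ ≤ alpha 0 (H n) + C / Real.log n := hα
    _ ≤ _ := by gcongr; exact le_max_left _ _

/-- Below `ψ_q` a positive fraction of the edges of a delocalized graph can be recovered. -/
lemma exists_eventually_mmse_le (hv : ∀ n, v n ≤ n) (h : IsDense H) {q C ρ : ℝ}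
    (hq0 : 0 < q) (hq : q ≤ 1) (hC : 0 ≤ C) (hρ0 : 0 < ρ) (hρ : ρ < 1)
    (hI : ∀ᶠ n in atTop, ∀ I : (H n).Subgraph, 1 ≤ Real.exp (C * edgeCount I.coe) *
        (psi n q (H n) ^ edgeCount I.coe * (n : ℝ) ^ I.verts.ncard)) :
    ∃ c, 0 < c ∧ ∀ᶠ n in atTop, ∀ p : unitInterval, p ≤ ρ * psi n q (H n) →
      mmse n (H n) p / edgeCount (H n) ≤ 1 - c := by
  set a := -Real.log ρ with ha_def
  have ha : 0 < a := neg_pos.2 (Real.log_neg hρ0 hρ)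
  -- Chosen so that `C * τ ≤ a * (q - τ) / 2`: the delocalization cost fits into half of the gain.
  set τ := a * q / (a + 2 * C + 1) with hτ_def
  have hden : 0 < a + 2 * C + 1 := by positivity
  have hτ : 0 < τ := by positivity
  have hτe : τ * (a + 2 * C + 1) = a * q := div_mul_cancel₀ _ hden.ne'
  have hτq : τ < q := by
    rw [hτ_def, div_lt_iff₀ hden]
    nlinarith
  refine ⟨τ / 2, by positivity, ?_⟩
  filter_upwards [h.eventually_mmse_le hv hτ hτq hq hρ0 hρ (δ := 1 / 2) (by norm_num), hI]
    with n h1 h2 p hp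
  refine (h1 p hp fun I hIτ => (h2 I).trans ?_).trans_eq (by ring)
  refine mul_le_mul_of_nonneg_right (Real.exp_le_exp.2 ?_) ?_
  · calc C * edgeCount I.coe ≤ C * (τ * edgeCount (H n)) := by gcongr
      _ = C * τ * edgeCount (H n) := by ring
      _ ≤ _ := by
        refine mul_le_mul_of_nonneg_right ?_ (by positivity)
        rw [← ha_def]
        nlinarith
  · have := (h2 I).trans' zero_le_one
    exact (mul_nonneg_iff_of_pos_left (Real.exp_pos _)).1 this

/-- Below the threshold of a delocalized and almost balanced graph, almost all of its edges can
be recovered. -/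
lemma IsAlmostBalanced.eventually_mmse_le (hv : ∀ n, v n ≤ n) (h : IsDense H)
    (hd : IsDelocalized H) (hb : IsAlmostBalanced H) {ε δ : ℝ} (hε : 0 < ε) (hε1 : ε < 1)
    (hδ : 0 < δ) :
    ∀ᶠ n in atTop, ∀ p : unitInterval, p ≤ (1 - ε) * psi n (1 / 2) (H n) →
      mmse n (H n) p / edgeCount (H n) ≤ δ := by
  obtain ⟨q₀, hq₀, C, hC, hI⟩ := hd.exists_bound hv h
  -- With `q = 1 - β`, `τ = 1 - 2β` and relative error `β`, the final bound is `1 - (1 - 2β)(1 - β)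
  -- ≤ 3β ≤ δ`.
  set β := min (δ / 3) (1 / 4) with hβ_def
  have hβ : 0 < β := by positivity
  have hβ1 : β ≤ 1 / 4 := min_le_right _ _
  have hβδ : β ≤ δ / 3 := min_le_left _ _
  have hq : 1 - β ∈ Set.Ioo (0 : ℝ) 1 := ⟨by linarith, by linarith⟩
  set ρ := 1 - ε / 2
  have hρ0 : 0 < ρ := by simp only [ρ]; linarith
  have hρ1 : ρ < 1 := by simp only [ρ]; linarith
  have ha : 0 < -Real.log ρ := neg_pos.2 (Real.log_neg hρ0 hρ1)
  set κ := -Real.log ρ * β / 2 with hκ_def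
  have hκ : 0 < κ := by positivity
  -- `q'` separates the two regimes. Above it, balance gives `ψ_{q'} ≤ exp(κ) ψ_{1-β}`. Below it,
  -- delocalization costs `C` per edge and `ψ_{q₀} ≤ exp(1) ψ_{1-β}` costs `1` more, in total at
  -- most `(C + 1) q' e(H) ≤ κ e(H)`.
  set q' := min (κ / (C + 1)) (1 / 2) with hq'_def
  have hq'0 : 0 < q' := by positivity
  have hq' : q' ∈ Set.Ioo (0 : ℝ) 1 := ⟨hq'0, (min_le_right _ _).trans_lt (by norm_num)⟩
  have hhalf : (1 / 2 : ℝ) ∈ Set.Ioo (0 : ℝ) 1 := by constructor <;> norm_num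
  have hr : 1 < (1 - ε / 2) / (1 - ε) := by rw [one_lt_div (by linarith)]; linarith
  have hτ0 : 0 < 1 - 2 * β := by linarith
  filter_upwards [h.eventually_mmse_le hv (τ := 1 - 2 * β) (q := 1 - β) hτ0 (by linarith)
      hq.2.le hρ0 hρ1 hβ, hI, h.eventually_pos,
    h.tendsto_edgeCount.eventually_ge_atTop (1 / q'),
    (hb _ hhalf _ hq).eventually_le_const hr,
    (hb _ hq' _ hq).eventually_le_const (Real.one_lt_exp_iff.2 hκ),
    (hb _ hq₀ _ hq).eventually_le_const (Real.one_lt_exp_iff.2 one_pos)]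
    with n h1 h2 ⟨hn, he⟩ hqe hr1 hr2 hr3 p hp
  have hn0 : 0 < n := by omega
  have hψ := psi_pos hn0 (hv n) hq.2.le he
  have hn' : (0 : ℝ) < n := by exact_mod_cast hn0
  rw [div_le_iff₀ hψ] at hr1 hr2 hr3
  rw [div_le_iff₀ hq'0, mul_comm] at hqe
  have hp' : (p : ℝ) ≤ ρ * psi n (1 - β) (H n) := by
    refine hp.trans ((mul_le_mul_of_nonneg_left hr1 (by linarith)).trans_eq ?_)
    rw [← mul_assoc, mul_div_cancel₀ _ (by linarith : (1 : ℝ) - ε ≠ 0)]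
  have hκ' : -Real.log ρ * (1 - β - (1 - 2 * β)) / 2 = κ := by rw [hκ_def]; ring
  have h3 := h1 p hp' fun I hIτ => by
    rw [hκ']
    by_cases hlarge : q' * edgeCount (H n) ≤ edgeCount I.coe
    · have h4 := one_le_psi_pow_mul hn0 (hv n) (I := I) (q := q') (max_le (hqe.trans hlarge) hlarge)
      have hψ' := psi_pos hn0 (hv n) hq'.2.le he
      refine h4.trans ?_
      rw [← mul_assoc]
      refine mul_le_mul_of_nonneg_right ?_ (by positivity)
      refine (pow_le_pow_left₀ hψ'.le hr2 _).trans ?_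
      rw [mul_pow, ← Real.exp_nat_mul]
      refine mul_le_mul_of_nonneg_right (Real.exp_le_exp.2 ?_) (by positivity)
      rw [mul_comm]
      exact mul_le_mul_of_nonneg_left (by exact_mod_cast edgeCount_coe_le I) hκ.le
    · have hψ' := psi_pos hn0 (hv n) hq₀.2.le he
      refine (h2 I).trans ?_
      rw [← mul_assoc, ← mul_assoc]
      refine mul_le_mul_of_nonneg_right ?_ (by positivity)
      refine (mul_le_mul_of_nonneg_left (pow_le_pow_left₀ hψ'.le hr3 _) (by positivity)).trans ?_
      rw [mul_pow, ← Real.exp_nat_mul, ← mul_assoc, ← Real.exp_add]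
      refine mul_le_mul_of_nonneg_right (Real.exp_le_exp.2 ?_) (by positivity)
      have h5 : q' * (C + 1) ≤ κ := by
        have := min_le_left (κ / (C + 1)) (1 / 2)
        rwa [← hq'_def, le_div_iff₀ (by positivity)] at this
      calc C * edgeCount I.coe + edgeCount I.coe * 1 = (C + 1) * edgeCount I.coe := by ring
        _ ≤ (C + 1) * (q' * edgeCount (H n)) :=
          mul_le_mul_of_nonneg_left (not_le.1 hlarge).le (by positivity)
        _ = q' * (C + 1) * edgeCount (H n) := by ring
        _ ≤ κ * edgeCount (H n) := by gcongr
  refine h3.trans ?_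
  nlinarith

theorem IsAlmostBalanced.exhibitsAoN (hv : ∀ n, v n ≤ n) (h : IsDense H)
    (hd : IsDelocalized H) (hb : IsAlmostBalanced H) : ExhibitsAoN H := by
  have hhalf : (1 / 2 : ℝ) ∈ Set.Ioo (0 : ℝ) 1 := by constructor <;> norm_num
  -- The projection only supplies the type: eventually `ψ_{1/2}` lies in `[0, 1]`.
  refine ⟨fun n => Set.projIcc 0 1 zero_le_one (psi n (1 / 2) (H n)), fun ε hε δ hδ => ?_⟩
  set ε' := min ε (1 / 2) with hε'_def
  have hε' : 0 < ε' := by positivity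
  set q := min (δ / 2) (1 / 2) with hq_def
  have hq0 : 0 < q := by positivity
  have hq : q ∈ Set.Ioo (0 : ℝ) 1 := ⟨hq0, (min_le_right _ _).trans_lt (by norm_num)⟩
  have hqδ : q ≤ δ / 2 := min_le_left _ _
  have hr : 1 < (1 + ε) / (1 + ε / 2) := by rw [one_lt_div (by linarith)]; linarith
  filter_upwards [h.eventually_pos,
    hb.eventually_mmse_le hv h hd hε' ((min_le_right _ _).trans_lt (by norm_num)) hδ,
    h.eventually_le_mmse hv hq0 hq.2.le (half_pos hε) (half_pos hδ),
    (hb _ hq _ hhalf).eventually_le_const hr] with n ⟨hn, he⟩ hall hnot hr1 p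
  have hn0 : 0 < n := by omega
  have he' : (0 : ℝ) < edgeCount (H n) := by exact_mod_cast he
  have hψ := psi_pos hn0 (hv n) hhalf.2.le he
  have hcoe : ((Set.projIcc (0 : ℝ) 1 zero_le_one (psi n (1 / 2) (H n)) : unitInterval) : ℝ) =
      psi n (1 / 2) (H n) := by
    rw [Set.projIcc_of_mem zero_le_one ⟨hψ.le, psi_le_one hn0 (hv n) hhalf.2.le he⟩]
  have hle1 : mmse n (H n) p / edgeCount (H n) ≤ 1 := by
    rw [div_le_one he']; exact mmse_le_edgeCount p hn0 (hv n)
  have hge0 : 0 ≤ mmse n (H n) p / edgeCount (H n) := div_nonneg (mmse_nonneg p) he'.le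
  rw [hcoe]
  refine ⟨fun hp => ?_, fun hp => ?_⟩
  · rw [div_le_iff₀ hψ] at hr1
    have h1 := hnot p (by
      refine le_trans ?_ hp
      refine (mul_le_mul_of_nonneg_left hr1 (by positivity)).trans_eq ?_
      rw [← mul_assoc, mul_div_cancel₀ _ (by positivity)])
    rw [abs_le]
    constructor <;> linarith
  · rw [abs_of_nonneg hge0]
    refine hall p (hp.trans ?_)
    refine mul_le_mul_of_nonneg_right ?_ hψ.le
    linarith [min_le_left ε (1 / 2)]

/-- Otherwise some `p` slightly below `pc` would still exceed `(1 + ε / 2) ψ_q`, where the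
normalized MMSE is bounded below by nearly `1 - q > 0` instead of vanishing. -/
lemma ExhibitsAoNAt.eventually_le (hv : ∀ n, v n ≤ n) (h : IsDense H) {pc : ℕ → unitInterval}
    (hpc : ExhibitsAoNAt H pc) {q ε : ℝ} (hq : q ∈ Set.Ioo (0 : ℝ) 1) (hε : 0 < ε) :
    ∀ᶠ n in atTop, (pc n : ℝ) / psi n q (H n) ≤ 1 + ε := by
  have hq1 : 0 < 1 - q := sub_pos.2 hq.2
  set ε' := (ε / 2) / (1 + ε) with hε'_def
  have hε' : 0 < ε' := by positivity
  have hε'1 : ε' < 1 := by rw [hε'_def, div_lt_one (by positivity)]; linarith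
  have hmul : (1 - ε') * (1 + ε) = 1 + ε / 2 := by
    rw [hε'_def, sub_mul, div_mul_cancel₀ _ (by positivity)]; ring
  filter_upwards [h.eventually_pos, hpc ε' hε' ((1 - q) / 4) (by positivity),
    h.eventually_le_mmse hv hq.1 hq.2.le (half_pos hε) (δ := (1 - q) / 4) (by positivity)]
    with n ⟨hn, he⟩ h1 h2
  have hψ := psi_pos (by omega) (hv n) hq.2.le he
  rw [div_le_iff₀ hψ]
  by_contra! hlt
  have hp0 : 0 ≤ (1 - ε') * (pc n : ℝ) := mul_nonneg (by linarith) (pc n).2.1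
  have hp1 : (1 - ε') * (pc n : ℝ) ≤ 1 :=
    mul_le_one₀ (by linarith) (pc n).2.1 (pc n).2.2
  have h3 := (h1 ⟨_, hp0, hp1⟩).2 le_rfl
  have h4 := h2 ⟨_, hp0, hp1⟩ (by
    rw [← hmul, mul_assoc]
    exact mul_le_mul_of_nonneg_left hlt.le (by linarith))
  have h5 := (abs_le.1 h3).2
  linarith

/-- Otherwise `p = (1 + ε) pc` would lie below `(1 - ε ^ 2) ψ_{q₁}` with `q₁ = min q q₀`, where a
positive fraction of the edges is recovered, although AoN makes the normalized MMSE close to `1`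
there. -/
lemma ExhibitsAoNAt.eventually_ge (hv : ∀ n, v n ≤ n) (h : IsDense H) (hd : IsDelocalized H)
    {pc : ℕ → unitInterval} (hpc : ExhibitsAoNAt H pc) {q ε : ℝ} (hq : q ∈ Set.Ioo (0 : ℝ) 1)
    (hε : 0 < ε) (hε1 : ε < 1) :
    ∀ᶠ n in atTop, 1 - ε ≤ (pc n : ℝ) / psi n q (H n) := by
  obtain ⟨q₀, hq₀, C, hC, hI⟩ := hd.exists_bound hv h
  set q₁ := min q q₀ with hq₁_def
  have hq₁ : 0 < q₁ := lt_min hq.1 hq₀.1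
  have hq₁1 : q₁ ≤ 1 := (min_le_left _ _).trans hq.2.le
  have hI' : ∀ᶠ n in atTop, ∀ I : (H n).Subgraph, 1 ≤ Real.exp (C * edgeCount I.coe) *
      (psi n q₁ (H n) ^ edgeCount I.coe * (n : ℝ) ^ I.verts.ncard) := by
    filter_upwards [hI, h.eventually_pos] with n h1 ⟨hn, he⟩ I
    have h2 := psi_pos (by omega) (hv n) hq₀.2.le he
    have h3 := psi_anti (n := n) (min_le_right q q₀) hq₀.2.le he
    refine (h1 I).trans ?_
    gcongr
  have hε2 : 0 < 1 - ε ^ 2 := by nlinarith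
  obtain ⟨c, hc, hc'⟩ := exists_eventually_mmse_le hv h hq₁ hq₁1 hC hε2 (by nlinarith) hI'
  filter_upwards [h.eventually_pos, hpc ε hε (c / 2) (by positivity), hc'] with n ⟨hn, he⟩ h1 h2
  have hn0 : 0 < n := by omega
  have hψ := psi_pos hn0 (hv n) hq.2.le he
  have hψ₁ := psi_pos hn0 (hv n) hq₁1 he
  rw [le_div_iff₀ hψ]
  by_contra! hlt
  have h3 := psi_anti (n := n) (min_le_left q q₀) hq.2.le he
  have hle : (1 + ε) * (pc n : ℝ) ≤ (1 - ε ^ 2) * psi n q₁ (H n) := by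
    calc (1 + ε) * (pc n : ℝ) ≤ (1 + ε) * ((1 - ε) * psi n q₁ (H n)) := by
          refine mul_le_mul_of_nonneg_left (hlt.le.trans ?_) (by linarith)
          exact mul_le_mul_of_nonneg_left h3 (by linarith)
      _ = _ := by ring
  have hp0 : 0 ≤ (1 + ε) * (pc n : ℝ) := mul_nonneg (by linarith) (pc n).2.1
  have hp1 : (1 + ε) * (pc n : ℝ) ≤ 1 := hle.trans
    (mul_le_one₀ (by nlinarith) hψ₁.le (psi_le_one hn0 (hv n) hq₁1 he))
  have h4 := (h1 ⟨_, hp0, hp1⟩).1 le_rfl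
  have h5 := h2 ⟨_, hp0, hp1⟩ hle
  have h6 := (abs_le.1 h4).1
  linarith

theorem ExhibitsAoNAt.tendsto_div_psi (hv : ∀ n, v n ≤ n) (h : IsDense H) (hd : IsDelocalized H)
    {pc : ℕ → unitInterval} (hpc : ExhibitsAoNAt H pc) {q : ℝ} (hq : q ∈ Set.Ioo (0 : ℝ) 1) :
    Tendsto (fun n => (pc n : ℝ) / psi n q (H n)) atTop (𝓝 1) := by
  rw [Metric.tendsto_nhds]
  intro ε hε
  set ε' := min (ε / 2) (1 / 2) with hε'_def
  have hε' : 0 < ε' := by positivity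
  have hle : ε' ≤ ε / 2 := min_le_left _ _
  filter_upwards [hpc.eventually_le hv h hq hε', hpc.eventually_ge hv h hd hq hε'
    ((min_le_right _ _).trans_lt (by norm_num))] with n h1 h2
  rw [Real.dist_eq, abs_lt]
  constructor <;> linarith

theorem ExhibitsAoN.isAlmostBalanced (hv : ∀ n, v n ≤ n) (h : IsDense H) (hd : IsDelocalized H)
    (hA : ExhibitsAoN H) : IsAlmostBalanced H := by
  obtain ⟨pc, hpc⟩ := hA
  intro q hq q' hq'
  have h1 := hpc.tendsto_div_psi hv h hd hq
  have h2 := (hpc.tendsto_div_psi hv h hd hq').div h1 one_ne_zero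
  rw [div_one] at h2
  refine h2.congr' ?_
  -- Cancelling `pc n` requires `pc n ≠ 0`, which holds once the ratio is nonzero.
  filter_upwards [h1.eventually_ne one_ne_zero] with n hn
  simp only [Pi.div_apply]
  rw [div_div_div_cancel_left' _ _ fun h0 => hn (by rw [h0, zero_div])]

end Asymptotics
end PlantedSubgraph

theorem theoremt (v : ℕ → ℕ) (hv : ∀ n, v n ≤ n) (H : ∀ n, SimpleGraph (Fin (v n)))
    (hdense : PlantedSubgraph.IsDense H) (hdeloc : PlantedSubgraph.IsDelocalized H) :
    (PlantedSubgraph.ExhibitsAoN H ↔ PlantedSubgraph.IsAlmostBalanced H) ∧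
    ∀ pc : ℕ → unitInterval, PlantedSubgraph.ExhibitsAoNAt H pc →
      ∀ q ∈ Set.Ioo (0 : ℝ) 1,
        Filter.Tendsto (fun n => (pc n : ℝ) / PlantedSubgraph.psi n q (H n))
          Filter.atTop (nhds 1) :=
  ⟨⟨fun h => h.isAlmostBalanced hv hdense hdeloc, fun h => h.exhibitsAoN hv hdense hdeloc⟩,
    fun _ hpc _ hq => hpc.tendsto_div_psi hv hdense hdeloc hq⟩
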